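/- Let $n$ be a natural number, let $\mathrm{Sym}_n$ be the space of real symmetric $n\times n$ matrices and let $\mathrm{Sym}_n^+$ be the manifold of symmetric positive definite $n\times n$ matrices, with tangent space $\mathrm{Sym}_n$ at every point. Equip $\mathrm{Sym}_n^+$ with one of the following Riemannian metrics, where $P\in\mathrm{Sym}_n^+$ and $V,W\in\mathrm{Sym}_n$: - the Log-Euclidean metric $\langle V,W\rangle_P=\langle D\log_P(V),D\log_P(W)\rangle_F$, where $\log$ is the matrix logarithm and $\langle\cdot,\cdot\rangle_F$ the Frobenius inner product; - the Log-Cholesky metric $\langle V,W\rangle_P=\sum_{i>j}X_{ij}Y_{ij}+\sum_j L_{jj}^{-2}X_{jj}Y_{jj}$, where $P=LL^{T}$ with $L$ lower triangular with positive diagonal, $X=L(L^{-1}VL^{-T})_{1/2}$, $Y=L(L^{-1}WL^{-T})_{1/2}$, and $Z_{1/2}$ is the lower triangular part of $Z$ with the diagonal entries halved; - the Affine-Invariant metric $\langle V,W\rangle_P=\operatorname{tr}(P^{-1}VP^{-1}W)=\langle P^{-1/2}VP^{-1/2},P^{-1/2}WP^{-1/2}\rangle_F$. Let $\operatorname{Exp}_P$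 and $\operatorname{Log}_P$ be the Riemannian exponential and logarithmic maps at $P$ of the chosen metric, and let $\mathcal T_{P\to Q}$ be the parallel transport (of its Levi-Civita connection) from $P$ to $Q$ along the geodesic connecting $P$ and $Q$. With $I$ the identity matrix, put $$P\oplus Q=\operatorname{Exp}_P\big(\mathcal T_{I\to P}(\operatorname{Log}_I(Q))\big),$$ let $\ominus P$ be the left inverse of $P$, that is $\ominus P\oplus P=I$, and define $$\langle P,Q\rangle=\langle\operatorname{Log}_I(P),\operatorname{Log}_I(Q)\rangle_I,\qquad \|P\|=\sqrt{\langle P,P\rangle},\qquad d(P,Q)=\|\ominus P\oplus Q\|.$$ Theorem. For each of the three metrics and every $A\in\mathrm{Sym}_n^+$, the left gyrotranslation $Q\mapsto A\oplus Q$ is a gyroisometry of $\mathrm{Sym}_n^+$: for all $P,Q\in\mathrm{Sym}_n^+$, $$d(A\oplus P,\,A\oplus Q)=d(P,Q).$$ -/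

import Mathlib

noncomputable section

namespace SPDGyro

open Matrix Set

/-- Real `n × n` matrices. -/
abbrev Mat (n : ℕ) := Matrix (Fin n) (Fin n) ℝ

/-- The manifold `Sym_n⁺` of real symmetric positive definite `n × n` matrices. It is an open subset
of the vector space of symmetric matrices, which is therefore its tangent space at every point. -/
abbrev SPD (n : ℕ) := {P : Mat n // P.PosDef}

/-- The identity matrix as a point of `Sym_n⁺`. -/
def SPD.one (n : ℕ) : SPD n := ⟨1, Matrix.PosDef.one⟩

instance (n : ℕ) : Nonempty (SPD n) := ⟨SPD.one n⟩

/-! ### The three Riemannian metrics -/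

/-- A (0,2)-tensor on `Sym_n⁺`: `g P V W` is the inner product at the point `P` of the tangent
vectors `V` and `W`. Only the values at `P` positive definite and `V`, `W` symmetric matter. -/
abbrev MetricTensor (n : ℕ) := Mat n → Mat n → Mat n → ℝ

/-- The Frobenius inner product. -/
def frobenius {n : ℕ} (V W : Mat n) : ℝ := ∑ i, ∑ j, V i j * W i j

/-- The principal matrix logarithm of a symmetric matrix (functional calculus). -/
def matLog {n : ℕ} (P : Mat n) : Mat n := cfc Real.log P

/-- The directional derivative of the matrix logarithm at `P` along `V`, entry by entry. -/
def dMatLog {n : ℕ} (P V : Mat n) : Mat n :=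
  Matrix.of fun i j => lineDeriv ℝ (fun X : Mat n => matLog X i j) P V

/-- The Log-Euclidean metric `⟨D log_P V, D log_P W⟩_F`. -/
def leMetric (n : ℕ) : MetricTensor n := fun P V W => frobenius (dMatLog P V) (dMatLog P W)

/-- `L` is the Cholesky factor of `P`: it is lower triangular with positive diagonal entries and
`P = L Lᵀ`. -/
structure IsCholeskyFactor {n : ℕ} (P L : Mat n) : Prop where
  lower : ∀ i j, i < j → L i j = 0
  diag_pos : ∀ i, 0 < L i i
  mul_transpose : L * Lᵀ = P

/-- The Cholesky factor of a positive definite matrix. -/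
def cholesky {n : ℕ} (P : Mat n) : Mat n := Classical.epsilon fun L => IsCholeskyFactor P L

/-- The lower triangular part of a matrix with the diagonal entries halved. -/
def lowerHalf {n : ℕ} (Y : Mat n) : Mat n :=
  Matrix.of fun i j => if j < i then Y i j else if i = j then Y i j / 2 else 0

/-- The differential `W ↦ L (L⁻¹ W L⁻ᵀ)_{1/2}` of the Cholesky map at `P`, with `L = cholesky P`. -/
def dCholesky {n : ℕ} (P W : Mat n) : Mat n :=
  cholesky P * lowerHalf ((cholesky P)⁻¹ * W * ((cholesky P)⁻¹)ᵀ)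

/-- The metric at `L` on lower triangular matrices with positive diagonal entries: Euclidean on the
strictly lower part, and the metric of `log L_jj` on the diagonal. -/
def triMetric (n : ℕ) : MetricTensor n := fun L X Y =>
  (∑ i, ∑ j, if j < i then X i j * Y i j else 0) + ∑ j, X j j * Y j j / (L j j) ^ 2

/-- The Log-Cholesky metric: the pull-back of `triMetric` under the Cholesky map. -/
def lcMetric (n : ℕ) : MetricTensor n := fun P V W =>
  triMetric n (cholesky P) (dCholesky P V) (dCholesky P W)

/-- The Affine-Invariant metric `tr (P⁻¹ V P⁻¹ W) = ⟨P^{-1/2} V P^{-1/2}, P^{-1/2} W P^{-1/2}⟩_F`. -/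
def aiMetric (n : ℕ) : MetricTensor n := fun P V W => (P⁻¹ * V * P⁻¹ * W).trace

/-- The names of the three metrics: Log-Euclidean, Log-Cholesky, Affine-Invariant. -/
inductive MetricName
  | le
  | lc
  | ai

/-- The metric with a given name. -/
def MetricName.tensor (g : MetricName) (n : ℕ) : MetricTensor n :=
  match g with
  | .le => leMetric n
  | .lc => lcMetric n
  | .ai => aiMetric n

/-! ### Levi-Civita parallel transport and geodesics -/

section Riemannian

variable {n : ℕ} (g : MetricTensor n)

/-- The Christoffel symbols of the first kind at `P`, in the global chart given by the vector space
of symmetric matrices: by Koszul's formula for constant vector fields this is `g_P (∇_U V, W)` for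
the Levi-Civita connection. -/
def christoffel (P U V W : Mat n) : ℝ :=
  (lineDeriv ℝ (fun X : Mat n => g X V W) P U + lineDeriv ℝ (fun X : Mat n => g X U W) P V
    - lineDeriv ℝ (fun X : Mat n => g X U V) P W) / 2

/-- `γ : [0,1] → Sym_n⁺` is a differentiable curve with velocity `v`. -/
def IsCurve (γ v : ℝ → Mat n) : Prop :=
  ∀ t ∈ Icc (0 : ℝ) 1, (γ t).PosDef ∧ HasDerivWithinAt γ (v t) (Icc 0 1) t

/-- `X` is a parallel vector field along the curve `γ : [0,1] → Sym_n⁺` with velocity `v`, for the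
Levi-Civita connection of `g`: the covariant derivative of `X` along `γ`, that is, `X'` plus the
Christoffel term, is orthogonal to every tangent vector `W`. -/
def IsParallelAlong (γ v X : ℝ → Mat n) : Prop :=
  ∀ t ∈ Icc (0 : ℝ) 1, (X t).IsSymm ∧ ∃ X' : Mat n, HasDerivWithinAt X X' (Icc 0 1) t ∧
    ∀ W : Mat n, W.IsSymm → g (γ t) X' W + christoffel g (γ t) (v t) (X t) W = 0

/-- `γ : [0,1] → Sym_n⁺` is a geodesic with velocity `v`: its velocity is parallel along it. -/
def IsGeodesic (γ v : ℝ → Mat n) : Prop :=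
  IsCurve γ v ∧ IsParallelAlong g γ v v

/-- The Riemannian exponential map: the endpoint at time `1` of the geodesic that starts at `P` with
velocity `V`. -/
def riemExp (P : SPD n) (V : Mat n) : SPD n :=
  Classical.epsilon fun Q : SPD n =>
    ∃ γ v, IsGeodesic g γ v ∧ γ 0 = P.1 ∧ v 0 = V ∧ γ 1 = Q.1

/-- The Riemannian logarithmic map: the initial velocity of the geodesic from `P` to `Q`. -/
def riemLog (P Q : SPD n) : Mat n :=
  Classical.epsilon fun V : Mat n =>
    ∃ γ v, IsGeodesic g γ v ∧ γ 0 = P.1 ∧ γ 1 = Q.1 ∧ v 0 = V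

/-- Parallel transport of a tangent vector `V` at `P` to `Q` along the geodesic from `P` to `Q`. -/
def transport (P Q : SPD n) (V : Mat n) : Mat n :=
  Classical.epsilon fun W : Mat n =>
    ∃ γ v X, IsGeodesic g γ v ∧ γ 0 = P.1 ∧ γ 1 = Q.1 ∧
      IsParallelAlong g γ v X ∧ X 0 = V ∧ X 1 = W

/-! ### The gyrovector operations, the gyrodistance and gyroisometries -/

/-- The binary operation `P ⊕ Q = Exp_P (T_{I → P} (Log_I Q))`. -/
def gyroAdd (P Q : SPD n) : SPD n :=
  riemExp g P (transport g (SPD.one n) P (riemLog g (SPD.one n) Q))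

/-- The left inverse `⊖ P`, with `⊖ P ⊕ P = I`. -/
def gyroNeg (P : SPD n) : SPD n :=
  Classical.epsilon fun N : SPD n => gyroAdd g N P = SPD.one n

/-- The SPD inner product `⟨P, Q⟩ = ⟨Log_I P, Log_I Q⟩_I`. -/
def spdInner (P Q : SPD n) : ℝ :=
  g 1 (riemLog g (SPD.one n) P) (riemLog g (SPD.one n) Q)

/-- The SPD norm. -/
def spdNorm (P : SPD n) : ℝ := √(spdInner g P P)

/-- The SPD gyrodistance `d(P, Q) = ‖⊖ P ⊕ Q‖`. -/
def gyroDist (P Q : SPD n) : ℝ := spdNorm g (gyroAdd g (gyroNeg g P) Q)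

/-- SPD gyroisometries: the maps that preserve the SPD gyrodistance. -/
def IsGyroisometry (ω : SPD n → SPD n) : Prop :=
  ∀ P Q : SPD n, gyroDist g (ω P) (ω Q) = gyroDist g P Q

/-- The left SPD gyrotranslation by `P`. -/
def leftGyrotranslation (P : SPD n) : SPD n → SPD n := fun Q => gyroAdd g P Q

end Riemannian

end SPDGyro

end

/-!
For the Log-Euclidean and the Log-Cholesky metric there is a global chart of `Sym_n⁺` onto a vector
space in which the metric is a constant bilinear form. In this chart geodesics are affine segments
and parallel vector fields are constant, so `P ⊕ Q` is the translation of `Q` by `P - I`.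

For the Affine-Invariant metric the geodesics from `I` are `t ↦ exp (t T)`, parallel transport along
them is the congruence by `exp (t T / 2)`, and congruences preserve the connection. This gives
`P ⊕ Q = P^{1/2} Q P^{1/2}`.

In both cases left gyrotranslations act through elements of a group in which the stabilizer of `I`
preserves the norm: it is trivial for translations, and consists of the orthogonal matrices, with
which `log` commutes, for congruences. The map taking `⊖P ⊕ Q` to `⊖(A ⊕ P) ⊕ (A ⊕ Q)` is given by
an element of this stabilizer, because it takes `⊖P ⊕ P = I` to `⊖(A ⊕ P) ⊕ (A ⊕ P) = I`.
-/

noncomputable section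

namespace SPDGyro

open Matrix Set Filter Topology NormedSpace
open scoped Matrix.Norms.L2Operator MatrixOrder

variable {n : ℕ}

section PositiveDefinite

variable {m : Type*} [Fintype m] [DecidableEq m]

theorem eventually_posDef {m : Type*} [Finite m] {P : Matrix m m ℝ} (hP : P.PosDef) :
    ∀ᶠ X in 𝓝 P, X.IsSymm → X.PosDef := by
  classical
  have := Fintype.ofFinite m
  rcases subsingleton_or_nontrivial (Matrix m m ℝ) with _ | _
  · exact Eventually.of_forall fun X _ => Subsingleton.elim P X ▸ hP
  have spectrum_pos := (CStarAlgebra.isStrictlyPositive_iff_isSelfAdjoint_and_spectrum_pos.1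
    hP.isStrictlyPositive).2
  obtain ⟨r, r_pos, r_le⟩ := (CFC.exists_pos_algebraMap_le_iff hP.isHermitian).2 spectrum_pos
  have near : ∀ᶠ X in 𝓝 P, ‖X - P‖ * ‖(1 : Matrix m m ℝ)‖ < r :=
    (Continuous.tendsto (by fun_prop) P).eventually_lt_const (by simpa using r_pos)
  filter_upwards [near] with X hX hXs
  have hXh : X.IsHermitian := isHermitian_iff_isSymm.2 hXs
  have le_diff : algebraMap ℝ (Matrix m m ℝ) (-(‖X - P‖ * ‖(1 : Matrix m m ℝ)‖)) ≤ X - P :=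
    algebraMap_le_of_le_spectrum
      (fun x hx => (abs_le.1 (spectrum.norm_le_norm_mul_of_mem hx)).1) (hXh.sub hP.isHermitian)
  have le_self := add_le_add r_le le_diff
  rw [← map_add, add_sub_cancel] at le_self
  exact isStrictlyPositive_iff_posDef.1
    (CStarAlgebra.isStrictlyPositive_iff_isSelfAdjoint_and_spectrum_pos.2
      ⟨hXh, (CFC.exists_pos_algebraMap_le_iff hXh).1 ⟨_, by linarith, le_self⟩⟩)

theorem posDef_exp {A : Matrix m m ℝ} (hA : A.IsSymm) : (exp A).PosDef :=
  have hA' : IsSelfAdjoint A := isHermitian_iff_isSymm.2 hA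
  isStrictlyPositive_iff_posDef.1 ((Matrix.isUnit_exp A).isStrictlyPositive hA'.exp_nonneg)

theorem exp_smul_mul_exp_smul (A : Matrix m m ℝ) (s t : ℝ) :
    exp (s • A) * exp (t • A) = exp ((s + t) • A) := by
  rw [add_smul, Matrix.exp_add_of_commute _ _ (((Commute.refl A).smul_left s).smul_right t)]

end PositiveDefinite

theorem isSymm_matLog (P : Mat n) : (matLog P).IsSymm :=
  isHermitian_iff_isSymm.1 (cfc_predicate Real.log P)

theorem matLog_exp {A : Mat n} (hA : A.IsSymm) : matLog (exp A) = A :=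
  CFC.log_exp A (isHermitian_iff_isSymm.2 hA)

theorem exp_matLog {P : Mat n} (hP : P.PosDef) : exp (matLog P) = P :=
  CFC.exp_log P hP.isStrictlyPositive

section Calculus

variable {E F : Type*} [NormedAddCommGroup E] [NormedSpace ℝ E] [NormedAddCommGroup F]
  [NormedSpace ℝ F]

theorem hasDerivWithinAt_fderiv_apply {f : E → F} {γ X : ℝ → E} {t : ℝ} {v X' : E} {s : Set ℝ}
    (hf : ContDiffAt ℝ 2 f (γ t)) (hγ : HasDerivWithinAt γ v s t)
    (hX : HasDerivWithinAt X X' s t) :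
    HasDerivWithinAt (fun r => fderiv ℝ f (γ r) (X r))
      (fderiv ℝ (fderiv ℝ f) (γ t) v (X t) + fderiv ℝ f (γ t) X') s t :=
  have h : HasFDerivAt (fderiv ℝ f) (fderiv ℝ (fderiv ℝ f) (γ t)) (γ t) :=
    ((hf.fderiv_right (m := 1) (by norm_num)).differentiableAt one_ne_zero).hasFDerivAt
  (h.comp_hasDerivWithinAt t hγ).clm_apply hX

theorem hasDerivAt_add_smul (a b : E) (t : ℝ) : HasDerivAt (fun r : ℝ => a + r • b) b t := by
  simpa only [id_eq, one_smul] using ((hasDerivAt_id t).smul_const b).const_add a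

theorem hasDerivAt_comp_add_smul {f : E → F} (a b : E) {t : ℝ}
    (hf : DifferentiableAt ℝ f (a + t • b)) :
    HasDerivAt (fun r : ℝ => f (a + r • b)) (fderiv ℝ f (a + t • b) b) t :=
  hf.hasFDerivAt.comp_hasDerivAt t (hasDerivAt_add_smul a b t)

theorem hasLineDerivAt_bilin_fderiv {f : E → F} {x : E} (hf : ContDiffAt ℝ 2 f x)
    (B : F →L[ℝ] F →L[ℝ] ℝ) (u v w : E) :
    HasLineDerivAt ℝ (fun y => B (fderiv ℝ f y v) (fderiv ℝ f y w))
      (B (fderiv ℝ (fderiv ℝ f) x u v) (fderiv ℝ f x w) +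
        B (fderiv ℝ f x v) (fderiv ℝ (fderiv ℝ f) x u w)) x u := by
  have h : HasFDerivAt (fderiv ℝ f) (fderiv ℝ (fderiv ℝ f) x) x :=
    ((hf.fderiv_right (m := 1) (by norm_num)).differentiableAt one_ne_zero).hasFDerivAt
  have happly (v : E) := h.clm_apply (hasFDerivAt_const v x)
  have := (B.hasFDerivAt_of_bilinear (happly v) (happly w)).hasLineDerivAt u
  simpa [add_comm] using this

theorem eq_of_hasDerivWithinAt_zero {f : ℝ → F}
    (hf : ∀ t ∈ Icc (0 : ℝ) 1, HasDerivWithinAt f 0 (Icc 0 1) t) {t : ℝ}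
    (ht : t ∈ Icc (0 : ℝ) 1) : f t = f 0 :=
  constant_of_has_deriv_right_zero (fun s hs => (hf s hs).continuousWithinAt)
    (fun s hs => (hf s (Ico_subset_Icc_self hs)).mono_of_mem_nhdsWithin
      (Icc_mem_nhdsGE_of_mem hs)) t ht

theorem eq_add_of_hasDerivWithinAt_const {f : ℝ → F} {b : F}
    (hf : ∀ t ∈ Icc (0 : ℝ) 1, HasDerivWithinAt f b (Icc 0 1) t) : f 1 = f 0 + b := by
  have hline (t : ℝ) := (hasDerivAt_add_smul (f 0) b t).hasDerivWithinAt (s := Icc 0 1)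
  have := eq_of_hasDerivWithinAt_zero (f := fun t => f t - (f 0 + t • b))
    (fun t ht => by simpa only [sub_self] using (hf t ht).fun_sub (hline t))
    (right_mem_Icc.2 zero_le_one)
  simpa [sub_eq_zero] using this

theorem commute_of_hasDerivAt_zero {𝔸 : Type*} [NormedRing 𝔸] [NormedAlgebra ℝ 𝔸] {x y : ℝ → 𝔸}
    {x' : 𝔸} {t : ℝ} (hx : HasDerivAt x x' t) (hy : HasDerivAt y 0 t)
    (hxy : ∀ s, Commute (x s) (y s)) : Commute x' (y t) := by
  have hleft := hx.fun_mul hy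
  have hright := hy.fun_mul hx
  simp only [fun s => (hxy s).eq] at hleft
  rw [commute_iff_eq]
  simpa only [mul_zero, add_zero, zero_mul, zero_add] using hleft.unique hright

end Calculus

section MatrixCalculus

variable {m : Type*} [Finite m]

theorem isSymm_of_hasDerivWithinAt {X : ℝ → Matrix m m ℝ} {X' : Matrix m m ℝ} {t : ℝ}
    (ht : t ∈ Icc (0 : ℝ) 1) (hX : HasDerivWithinAt X X' (Icc 0 1) t)
    (hs : ∀ t ∈ Icc (0 : ℝ) 1, (X t).IsSymm) : X'.IsSymm := by
  classical
  have := Fintype.ofFinite m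
  refine isHermitian_iff_isSymm.1 ?_
  refine (uniqueDiffOn_Icc zero_lt_one t ht).eq_deriv _ ?_ hX
  exact hX.star.congr (fun s h => (isHermitian_iff_isSymm.2 (hs s h)).eq.symm)
    (isHermitian_iff_isSymm.2 (hs t ht)).eq.symm

theorem isSymm_fderiv {F : Type*} [NormedAddCommGroup F] [NormedSpace ℝ F]
    {f : F → Matrix m m ℝ} {y : F} (hf : DifferentiableAt ℝ f y) (hs : ∀ z, (f z).IsSymm) (b : F) :
    (fderiv ℝ f y b).IsSymm := by
  classical
  have := Fintype.ofFinite m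
  have hline := hasDerivAt_comp_add_smul (t := 0) y b (by simpa using hf)
  rw [zero_smul, add_zero] at hline
  exact isSymm_of_hasDerivWithinAt (left_mem_Icc.2 zero_le_one) hline.hasDerivWithinAt
    fun t _ => hs _

theorem eventually_posDef_add_smul {P U : Matrix m m ℝ} (hP : P.PosDef) (hU : U.IsSymm) :
    ∀ᶠ t : ℝ in 𝓝 0, (P + t • U).PosDef := by
  have tendsto_line : Tendsto (fun t : ℝ => P + t • U) (𝓝 0) (𝓝 P) :=
    Continuous.tendsto' (by fun_prop) _ _ (by simp)
  filter_upwards [tendsto_line.eventually (eventually_posDef hP)] with t ht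
  exact ht ((isHermitian_iff_isSymm.1 hP.isHermitian).add (hU.smul t))

theorem contDiff_matrix_exp {m : Type*} [Fintype m] [DecidableEq m] {k : WithTop ℕ∞} :
    ContDiff ℝ k (exp : Matrix m m ℝ → Matrix m m ℝ) :=
  contDiff_iff_contDiffAt.2 fun A => (NormedSpace.exp_analytic (𝕂 := ℝ) A).contDiffAt

end MatrixCalculus

theorem commute_of_commute_exp {A V : Mat n} (hA : A.IsSymm) (h : Commute (exp A) V) :
    Commute A V := by
  have hstar : Commute (star (exp A)) V := by
    rwa [(posDef_exp hA).isHermitian.isSelfAdjoint.star_eq]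
  simpa only [matLog_exp hA] using show Commute (matLog (exp A)) V from h.cfc hstar Real.log

/-- If `d/dt exp (A + t V)` vanishes at `0`, then `V` commutes with `exp A`, hence with `A`, so that
the derivative is also `exp A * V`. -/
theorem fderiv_exp_injective {A : Mat n} (hA : A.IsSymm) :
    Function.Injective (fderiv ℝ (exp : Mat n → Mat n) A) := by
  refine (injective_iff_map_eq_zero _).2 fun V hV => ?_
  have hline : HasDerivAt (fun t : ℝ => exp (A + t • V)) 0 0 := by
    simpa [hV] using hasDerivAt_comp_add_smul (t := 0) (f := (exp : Mat n → Mat n)) A V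
      (contDiff_matrix_exp.differentiable one_ne_zero _)
  have commute_exp : Commute (exp A) V := by
    simpa using (commute_of_hasDerivAt_zero (hasDerivAt_add_smul A V 0) hline
      fun s => (Commute.refl (A + s • V)).exp_right).symm
  have commute_base := commute_of_commute_exp hA commute_exp
  have hmul : HasDerivAt (fun t : ℝ => exp (A + t • V)) (exp A * V) 0 := by
    simp_rw [fun t : ℝ => Matrix.exp_add_of_commute _ _ (commute_base.smul_right t)]
    simpa using (hasDerivAt_exp_smul_const V (0 : ℝ)).const_mul (exp A)
  exact (Matrix.isUnit_exp A).mul_right_eq_zero.1 (hmul.unique hline)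

/-! ### Metrics that are constant in a global chart -/

section Gyroisometry

theorem gyroNeg_gyroAdd_self {g : MetricTensor n} {P : SPD n}
    (h : ∃ N, gyroAdd g N P = SPD.one n) : gyroAdd g (gyroNeg g P) P = SPD.one n :=
  Classical.epsilon_spec h

/-- With `a`, `b`, `c` the group elements of `A`, `⊖P` and `⊖(A ⊕ P)`, the element `c * a * b⁻¹`
fixes the identity matrix because `b` and `c * a` both send `P` to it. -/
theorem isGyroisometry_leftGyrotranslation_of_mulAction {G : Type*} [Group G] [MulAction G (SPD n)]
    {g : MetricTensor n} (hadd : ∀ P, ∃ a : G, ∀ Q, gyroAdd g P Q = a • Q)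
    (hneg : ∀ P, ∃ N, gyroAdd g N P = SPD.one n)
    (hnorm : ∀ a : G, a • SPD.one n = SPD.one n → ∀ Q, spdNorm g (a • Q) = spdNorm g Q)
    (A : SPD n) : IsGyroisometry g (leftGyrotranslation g A) := by
  intro P Q
  obtain ⟨a, ha⟩ := hadd A
  obtain ⟨b, hb⟩ := hadd (gyroNeg g P)
  obtain ⟨c, hc⟩ := hadd (gyroNeg g (gyroAdd g A P))
  have hbP : b • P = SPD.one n := by rw [← hb, gyroNeg_gyroAdd_self (hneg P)]
  have hcaP : c • a • P = SPD.one n := by rw [← ha, ← hc, gyroNeg_gyroAdd_self (hneg _)]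
  have hfix : (c * a * b⁻¹) • SPD.one n = SPD.one n := by
    rw [← hbP, mul_smul, inv_smul_smul, mul_smul, hcaP, hbP]
  have hQ : c • a • Q = (c * a * b⁻¹) • b • Q := by simp only [mul_smul, inv_smul_smul]
  simp only [leftGyrotranslation, gyroDist, hc, hb]
  rw [ha Q, hQ, hnorm _ hfix]

end Gyroisometry

/-- A global `C²` chart of `Sym_n⁺` onto a normed space `F`. The chart map is defined on all
matrices, so that its derivatives can be taken in the ambient space. -/
structure SPDChart (n : ℕ) (F : Type*) [NormedAddCommGroup F] [NormedSpace ℝ F] where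
  toFun : Mat n → F
  invFun : F → Mat n
  contDiffAt_toFun : ∀ P : Mat n, P.PosDef → ContDiffAt ℝ 2 toFun P
  contDiff_invFun : ContDiff ℝ 2 invFun
  posDef_invFun : ∀ y, (invFun y).PosDef
  right_inv : ∀ y, toFun (invFun y) = y
  left_inv : ∀ P : Mat n, P.PosDef → invFun (toFun P) = P

/-- A global chart of `Sym_n⁺` in which the metric tensor `g` is a constant nondegenerate symmetric
bilinear form. -/
structure FlatChart (g : MetricTensor n) (F : Type*) [NormedAddCommGroup F] [NormedSpace ℝ F]
    extends SPDChart n F where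
  form : F →L[ℝ] F →L[ℝ] ℝ
  form_symm : ∀ x y, form x y = form y x
  form_injective : Function.Injective form
  metric_eq : ∀ P V W : Mat n, P.PosDef → V.IsSymm → W.IsSymm →
    g P V W = form (fderiv ℝ toFun P V) (fderiv ℝ toFun P W)

namespace SPDChart

variable {F : Type*} [NormedAddCommGroup F] [NormedSpace ℝ F] (c : SPDChart n F)

/-- The bijection between `Sym_n⁺` and `F` underlying a chart. -/
def equiv : SPD n ≃ F where
  toFun P := c.toFun P
  invFun y := ⟨c.invFun y, c.posDef_invFun y⟩
  left_inv P := Subtype.ext (c.left_inv P P.2)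
  right_inv := c.right_inv

theorem hasFDerivAt_toFun {P : Mat n} (hP : P.PosDef) :
    HasFDerivAt c.toFun (fderiv ℝ c.toFun P) P :=
  ((c.contDiffAt_toFun P hP).differentiableAt two_ne_zero).hasFDerivAt

theorem hasFDerivAt_invFun (y : F) : HasFDerivAt c.invFun (fderiv ℝ c.invFun y) y :=
  (c.contDiff_invFun.differentiable two_ne_zero y).hasFDerivAt

theorem isSymm_fderiv_invFun (y b : F) : (fderiv ℝ c.invFun y b).IsSymm :=
  isSymm_fderiv (c.hasFDerivAt_invFun y).differentiableAt
    (fun y => isHermitian_iff_isSymm.1 (c.posDef_invFun y).isHermitian) b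

theorem fderiv_toFun_fderiv_invFun (y b : F) :
    fderiv ℝ c.toFun (c.invFun y) (fderiv ℝ c.invFun y b) = b := by
  have hcomp := (c.hasFDerivAt_toFun (c.posDef_invFun y)).comp y (c.hasFDerivAt_invFun y)
  rw [funext c.right_inv (f := c.toFun ∘ c.invFun) (g := id)] at hcomp
  exact DFunLike.congr_fun (hcomp.unique (hasFDerivAt_id y)) b

theorem fderiv_invFun_fderiv_toFun {P V : Mat n} (hP : P.PosDef) (hV : V.IsSymm) :
    fderiv ℝ c.invFun (c.toFun P) (fderiv ℝ c.toFun P V) = V := by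
  have hcomp := (c.hasFDerivAt_invFun (c.toFun P)).comp P (c.hasFDerivAt_toFun hP)
  refine (hcomp.hasLineDerivAt V).unique (HasDerivAt.congr_of_eventuallyEq
    (hasDerivAt_add_smul P V 0) ?_)
  filter_upwards [eventually_posDef_add_smul hP hV] with t ht using c.left_inv _ ht

theorem exists_isSymm_fderiv_toFun_eq {P : Mat n} (hP : P.PosDef) (b : F) :
    ∃ V : Mat n, V.IsSymm ∧ fderiv ℝ c.toFun P V = b := by
  have h := c.fderiv_toFun_fderiv_invFun (c.toFun P) b
  rw [c.left_inv P hP] at h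
  exact ⟨_, c.isSymm_fderiv_invFun _ _, h⟩

end SPDChart

namespace FlatChart

variable {g : MetricTensor n} {F : Type*} [NormedAddCommGroup F] [NormedSpace ℝ F]
  (c : FlatChart g F)

theorem lineDeriv_metric {P U V W : Mat n} (hP : P.PosDef) (hU : U.IsSymm) (hV : V.IsSymm)
    (hW : W.IsSymm) : lineDeriv ℝ (fun X : Mat n => g X V W) P U =
      c.form (fderiv ℝ (fderiv ℝ c.toFun) P U V) (fderiv ℝ c.toFun P W) +
        c.form (fderiv ℝ c.toFun P V) (fderiv ℝ (fderiv ℝ c.toFun) P U W) := by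
  refine (HasDerivAt.congr_of_eventuallyEq
    (hasLineDerivAt_bilin_fderiv (c.contDiffAt_toFun P hP) c.form U V W) ?_).deriv
  filter_upwards [eventually_posDef_add_smul hP hU] with t ht using c.metric_eq _ V W ht hV hW

theorem christoffel_eq {P U V W : Mat n} (hP : P.PosDef) (hU : U.IsSymm) (hV : V.IsSymm)
    (hW : W.IsSymm) : christoffel g P U V W =
      c.form (fderiv ℝ (fderiv ℝ c.toFun) P U V) (fderiv ℝ c.toFun P W) := by
  have hsymm : IsSymmSndFDerivAt ℝ c.toFun P :=
    (c.contDiffAt_toFun P hP).isSymmSndFDerivAt (by simp)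
  rw [christoffel, c.lineDeriv_metric hP hU hV hW, c.lineDeriv_metric hP hV hU hW,
    c.lineDeriv_metric hP hW hU hV, hsymm V U, hsymm W U, hsymm W V,
    c.form_symm (fderiv ℝ (fderiv ℝ c.toFun) P U W)]
  ring

theorem metric_add_christoffel {P v X X' W : Mat n} (hP : P.PosDef) (hv : v.IsSymm)
    (hX : X.IsSymm) (hX' : X'.IsSymm) (hW : W.IsSymm) :
    g P X' W + christoffel g P v X W =
      c.form (fderiv ℝ (fderiv ℝ c.toFun) P v X + fderiv ℝ c.toFun P X')
        (fderiv ℝ c.toFun P W) := by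
  rw [c.metric_eq _ _ _ hP hX' hW, c.christoffel_eq hP hv hX hW, map_add, _root_.add_apply,
    add_comm]

theorem covariantDeriv_eq_zero {P v X X' : Mat n} (hP : P.PosDef) (hv : v.IsSymm) (hX : X.IsSymm)
    (hX' : X'.IsSymm) (h : ∀ W : Mat n, W.IsSymm → g P X' W + christoffel g P v X W = 0) :
    fderiv ℝ (fderiv ℝ c.toFun) P v X + fderiv ℝ c.toFun P X' = 0 := by
  refine (map_eq_zero_iff c.form c.form_injective).1 (ContinuousLinearMap.ext fun y => ?_)
  obtain ⟨W, hW, rfl⟩ := c.exists_isSymm_fderiv_toFun_eq hP y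
  exact (c.metric_add_christoffel hP hv hX hX' hW).symm.trans (h W hW)

theorem fderiv_toFun_eq_of_isParallelAlong {γ v X : ℝ → Mat n} (hγ : IsGeodesic g γ v)
    (hX : IsParallelAlong g γ v X) {t : ℝ} (ht : t ∈ Icc (0 : ℝ) 1) :
    fderiv ℝ c.toFun (γ t) (X t) = fderiv ℝ c.toFun (γ 0) (X 0) := by
  refine eq_of_hasDerivWithinAt_zero (f := fun t => fderiv ℝ c.toFun (γ t) (X t))
    (fun s hs => ?_) ht
  obtain ⟨hP, hγ'⟩ := hγ.1 s hs
  obtain ⟨hXs, X', hX', hparallel⟩ := hX s hs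
  have hXs' := isSymm_of_hasDerivWithinAt hs hX' fun r hr => (hX r hr).1
  have hderiv := hasDerivWithinAt_fderiv_apply (c.contDiffAt_toFun _ hP) hγ' hX'
  rwa [c.covariantDeriv_eq_zero hP (hγ.2 s hs).1 hXs hXs' hparallel] at hderiv

theorem toFun_eq_of_isGeodesic {γ v : ℝ → Mat n} (h : IsGeodesic g γ v) :
    c.toFun (γ 1) = c.toFun (γ 0) + fderiv ℝ c.toFun (γ 0) (v 0) := by
  refine eq_add_of_hasDerivWithinAt_const (f := fun t => c.toFun (γ t)) fun t ht => ?_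
  rw [← c.fderiv_toFun_eq_of_isParallelAlong h h.2 ht]
  exact (c.hasFDerivAt_toFun (h.1 t ht).1).comp_hasDerivWithinAt t (h.1 t ht).2

theorem isCurve_invFun_add_smul (a b : F) :
    IsCurve (fun t => c.invFun (a + t • b)) (fun t => fderiv ℝ c.invFun (a + t • b) b) :=
  fun _ _ => ⟨c.posDef_invFun _,
    (hasDerivAt_comp_add_smul a b (c.hasFDerivAt_invFun _).differentiableAt).hasDerivWithinAt⟩

theorem isParallelAlong_invFun_add_smul (a b x : F) :
    IsParallelAlong g (fun t => c.invFun (a + t • b)) (fun t => fderiv ℝ c.invFun (a + t • b) b)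
      (fun t => fderiv ℝ c.invFun (a + t • b) x) := by
  intro t ht
  have hX := hasDerivWithinAt_fderiv_apply (s := Icc 0 1) (c.contDiff_invFun.contDiffAt)
    (hasDerivAt_add_smul a b t).hasDerivWithinAt (hasDerivWithinAt_const t _ x)
  refine ⟨c.isSymm_fderiv_invFun _ _, _, hX, fun W hW => ?_⟩
  have hX' := isSymm_of_hasDerivWithinAt ht hX fun r _ => c.isSymm_fderiv_invFun _ _
  obtain ⟨hP, hγ⟩ := c.isCurve_invFun_add_smul a b t ht
  have hderiv := hasDerivWithinAt_fderiv_apply (c.contDiffAt_toFun _ hP) hγ hX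
  simp only [c.fderiv_toFun_fderiv_invFun] at hderiv
  rw [c.metric_add_christoffel hP (c.isSymm_fderiv_invFun _ _) (c.isSymm_fderiv_invFun _ _) hX' hW,
    (uniqueDiffOn_Icc zero_lt_one t ht).eq_deriv _ hderiv (hasDerivWithinAt_const t _ x),
    map_zero, _root_.zero_apply]

theorem isGeodesic_invFun_add_smul (a b : F) :
    IsGeodesic g (fun t => c.invFun (a + t • b)) (fun t => fderiv ℝ c.invFun (a + t • b) b) :=
  ⟨c.isCurve_invFun_add_smul a b, c.isParallelAlong_invFun_add_smul a b b⟩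

theorem toFun_riemExp (P : SPD n) {V : Mat n} (hV : V.IsSymm) :
    c.toFun (riemExp g P V) = c.toFun P + fderiv ℝ c.toFun P V := by
  have hex : ∃ Q : SPD n, ∃ γ v, IsGeodesic g γ v ∧ γ 0 = P.1 ∧ v 0 = V ∧ γ 1 = Q.1 :=
    ⟨⟨_, c.posDef_invFun _⟩, _, _,
      c.isGeodesic_invFun_add_smul (c.toFun P) (fderiv ℝ c.toFun P V),
      by simpa using c.left_inv _ P.2, by simpa using c.fderiv_invFun_fderiv_toFun P.2 hV, rfl⟩
  obtain ⟨γ, v, hγ, h0, hv, h1⟩ := Classical.epsilon_spec hex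
  have hend := c.toFun_eq_of_isGeodesic hγ
  rwa [h0, hv, h1] at hend

theorem isSymm_riemLog_and_fderiv_toFun_riemLog (P Q : SPD n) : (riemLog g P Q).IsSymm ∧
    fderiv ℝ c.toFun P (riemLog g P Q) = c.toFun Q - c.toFun P := by
  have hex : ∃ V : Mat n, ∃ γ v, IsGeodesic g γ v ∧ γ 0 = P.1 ∧ γ 1 = Q.1 ∧ v 0 = V :=
    ⟨_, _, _, c.isGeodesic_invFun_add_smul (c.toFun P) (c.toFun Q - c.toFun P),
      by simpa using c.left_inv _ P.2, by simpa using c.left_inv _ Q.2, rfl⟩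
  obtain ⟨γ, v, hγ, h0, h1, hv⟩ := Classical.epsilon_spec hex
  have hend := c.toFun_eq_of_isGeodesic hγ
  have hsymm := (hγ.2 0 (left_mem_Icc.2 zero_le_one)).1
  rw [h0, h1, hv] at hend
  rw [hv] at hsymm
  exact ⟨hsymm, eq_sub_of_add_eq' hend.symm⟩

theorem isSymm_transport_and_fderiv_toFun_transport (P Q : SPD n) {V : Mat n} (hV : V.IsSymm) :
    (transport g P Q V).IsSymm ∧
      fderiv ℝ c.toFun Q (transport g P Q V) = fderiv ℝ c.toFun P V := by
  have hex : ∃ W : Mat n, ∃ γ v X, IsGeodesic g γ v ∧ γ 0 = P.1 ∧ γ 1 = Q.1 ∧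
      IsParallelAlong g γ v X ∧ X 0 = V ∧ X 1 = W :=
    ⟨_, _, _, _, c.isGeodesic_invFun_add_smul (c.toFun P) (c.toFun Q - c.toFun P),
      by simpa using c.left_inv _ P.2, by simpa using c.left_inv _ Q.2,
      c.isParallelAlong_invFun_add_smul _ _ (fderiv ℝ c.toFun P V),
      by simpa using c.fderiv_invFun_fderiv_toFun P.2 hV, rfl⟩
  obtain ⟨γ, v, X, hγ, h0, h1, hX, hX0, hX1⟩ := Classical.epsilon_spec hex
  have one_mem : (1 : ℝ) ∈ Icc (0 : ℝ) 1 := right_mem_Icc.2 zero_le_one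
  have hend := c.fderiv_toFun_eq_of_isParallelAlong hγ hX one_mem
  have hsymm := (hX 1 one_mem).1
  rw [h0, h1, hX0, hX1] at hend
  rw [hX1] at hsymm
  exact ⟨hsymm, hend⟩

theorem equiv_gyroAdd (P Q : SPD n) :
    c.equiv (gyroAdd g P Q) = c.equiv P + (c.equiv Q - c.equiv (SPD.one n)) := by
  obtain ⟨hlog_symm, hlog⟩ := c.isSymm_riemLog_and_fderiv_toFun_riemLog (SPD.one n) Q
  obtain ⟨htransport_symm, htransport⟩ :=
    c.isSymm_transport_and_fderiv_toFun_transport (SPD.one n) P hlog_symm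
  rw [hlog] at htransport
  exact (c.toFun_riemExp P htransport_symm).trans (congrArg _ htransport)

end FlatChart

theorem FlatChart.isGyroisometry_leftGyrotranslation {g : MetricTensor n} {F : Type*}
    [NormedAddCommGroup F] [NormedSpace ℝ F] (c : FlatChart g F) (P : SPD n) :
    IsGyroisometry g (leftGyrotranslation g P) := by
  let : MulAction (Multiplicative F) (SPD n) := c.equiv.mulAction (Multiplicative F)
  have equiv_smul (a : Multiplicative F) (Q : SPD n) : c.equiv (a • Q) = a.toAdd + c.equiv Q :=
    c.equiv.apply_symm_apply _
  refine isGyroisometry_leftGyrotranslation_of_mulAction (G := Multiplicative F)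
    (fun A => ⟨.ofAdd (c.equiv A - c.equiv (SPD.one n)), fun Q => ?_⟩)
    (fun A => ⟨c.equiv.symm (c.equiv (SPD.one n) - (c.equiv A - c.equiv (SPD.one n))), ?_⟩)
    (fun a ha Q => ?_) P
  · apply c.equiv.injective
    rw [c.equiv_gyroAdd, equiv_smul, toAdd_ofAdd]
    abel
  · apply c.equiv.injective
    rw [c.equiv_gyroAdd, c.equiv.apply_symm_apply, sub_add_cancel]
  · have ha' := congrArg c.equiv ha
    rw [equiv_smul, add_eq_right] at ha'
    rw [toAdd_eq_zero.1 ha', one_smul]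

/-! ### The Log-Euclidean metric -/

theorem contDiffAt_of_leftInverse {E F : Type*} [NormedAddCommGroup E] [NormedSpace ℝ E]
    [CompleteSpace E] [NormedAddCommGroup F] [NormedSpace ℝ F] [CompleteSpace F] {f : E → F}
    {φ : F → E} {k : WithTop ℕ∞} (hk : k ≠ 0) {x : E} (hf : ContDiffAt ℝ k f x)
    (hbij : Function.Bijective (fderiv ℝ f x)) (hφ : Function.LeftInverse φ f) :
    ContDiffAt ℝ k φ (f x) := by
  let e : E ≃L[ℝ] F := .ofBijective (fderiv ℝ f x) (LinearMap.ker_eq_bot.2 hbij.1)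
    (LinearMap.range_eq_top.2 hbij.2)
  have hf' : HasFDerivAt f (e : E →L[ℝ] F) x := (hf.differentiableAt hk).hasFDerivAt
  refine (hf.to_localInverse hf' hk).congr_of_eventuallyEq ?_
  filter_upwards [(hf.hasStrictFDerivAt' hf' hk).eventually_right_inverse] with z hz
  conv_lhs => rw [← hz]
  exact hφ _

instance : FiniteDimensional ℝ (selfAdjoint (Mat n)) :=
  inferInstanceAs (FiniteDimensional ℝ (selfAdjoint.submodule ℝ (Mat n)))

instance : CompleteSpace (selfAdjoint (Mat n)) := FiniteDimensional.complete ℝ _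

/-- The inclusion of the symmetric matrices into all matrices, as a continuous linear map. -/
def selfAdjointSubtypeL (n : ℕ) : selfAdjoint (Mat n) →L[ℝ] Mat n :=
  (selfAdjoint.submodule ℝ (Mat n)).subtypeL

/-- The chart of `Sym_n⁺` with a given inverse `f`. The inverse `φ` of `f` is extended to all
matrices through the symmetric part. -/
def SPDChart.ofInverse {F : Type*} [NormedAddCommGroup F] [NormedSpace ℝ F] [CompleteSpace F]
    (f : F → selfAdjoint (Mat n)) (φ : Mat n → F) (hf : ContDiff ℝ 2 f)
    (hpos : ∀ y, (f y : Mat n).PosDef) (hbij : ∀ y, Function.Bijective (fderiv ℝ f y))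
    (hr : ∀ y, φ (f y) = y) (hl : ∀ P : Mat n, P.PosDef → f (φ P) = P) : SPDChart n F where
  toFun X := φ (selfAdjointPart ℝ X)
  invFun y := f y
  contDiffAt_toFun P hP := by
    have hpart : f (φ P) = selfAdjointPartL ℝ (Mat n) P :=
      Subtype.ext ((hl P hP).trans (hP.isHermitian.isSelfAdjoint.coe_selfAdjointPart_apply ℝ).symm)
    have hφ := contDiffAt_of_leftInverse (φ := fun Y : selfAdjoint (Mat n) => φ Y) two_ne_zero
      hf.contDiffAt (hbij (φ P)) hr
    rw [hpart] at hφ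
    exact hφ.comp P (selfAdjointPartL ℝ (Mat n)).contDiff.contDiffAt
  contDiff_invFun := (selfAdjointSubtypeL n).contDiff.comp hf
  posDef_invFun := hpos
  right_inv y := by rw [IsSelfAdjoint.coe_selfAdjointPart_apply ℝ (f y).2, hr]
  left_inv P hP := by rw [hP.isHermitian.isSelfAdjoint.coe_selfAdjointPart_apply ℝ, hl P hP]

theorem contDiff_selfAdjoint_mk {F : Type*} [NormedAddCommGroup F] [NormedSpace ℝ F]
    {k : WithTop ℕ∞} {f : F → Mat n} (hf : ContDiff ℝ k f) (hs : ∀ y, IsSelfAdjoint (f y)) :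
    ContDiff ℝ k fun y => (⟨f y, hs y⟩ : selfAdjoint (Mat n)) := by
  convert (selfAdjointPartL ℝ (Mat n)).contDiff.comp hf using 1
  exact funext fun y => Subtype.ext ((hs y).coe_selfAdjointPart_apply ℝ).symm

theorem coe_fderiv_selfAdjoint {F : Type*} [NormedAddCommGroup F] [NormedSpace ℝ F]
    {f : F → selfAdjoint (Mat n)} {y : F} (hf : DifferentiableAt ℝ f y) (b : F) :
    (fderiv ℝ f y b : Mat n) = fderiv ℝ (fun z => (f z : Mat n)) y b :=
  (DFunLike.congr_fun ((selfAdjointSubtypeL n).hasFDerivAt.comp y hf.hasFDerivAt).fderiv b).symm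

section Frobenius

/-- The Frobenius inner product as a continuous bilinear form. -/
def frobeniusL (n : ℕ) : Mat n →L[ℝ] Mat n →L[ℝ] ℝ :=
  (LinearMap.mk₂ ℝ frobenius
    (fun V V' W => by simp only [frobenius, Matrix.add_apply, add_mul, Finset.sum_add_distrib])
    (fun r V W => by
      simp only [frobenius, Matrix.smul_apply, smul_eq_mul, mul_assoc, Finset.mul_sum])
    (fun V W W' => by simp only [frobenius, Matrix.add_apply, mul_add, Finset.sum_add_distrib])
    (fun r V W => by
      simp only [frobenius, Matrix.smul_apply, smul_eq_mul, mul_left_comm,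
        Finset.mul_sum])).toContinuousBilinearMap

theorem frobenius_comm (V W : Mat n) : frobenius V W = frobenius W V := by
  simp only [frobenius, mul_comm]

theorem frobenius_eq_trace (V W : Mat n) : frobenius V W = (Vᴴ * W).trace := by
  simp only [frobenius, Matrix.trace, Matrix.diag_apply, Matrix.mul_apply,
    conjTranspose_eq_transpose_of_trivial, Matrix.transpose_apply]
  exact Finset.sum_comm

/-- The pull-back of the Frobenius inner product under a linear map `ι`. -/
def frobeniusComap {F : Type*} [NormedAddCommGroup F] [NormedSpace ℝ F] (ι : F →L[ℝ] Mat n) :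
    F →L[ℝ] F →L[ℝ] ℝ :=
  (frobeniusL n).bilinearComp ι ι

theorem frobeniusComap_injective {F : Type*} [NormedAddCommGroup F] [NormedSpace ℝ F]
    {ι : F →L[ℝ] Mat n} (hι : Function.Injective ι) : Function.Injective (frobeniusComap ι) := by
  refine (injective_iff_map_eq_zero _).2 fun x hx => (map_eq_zero_iff ι hι).1 ?_
  rw [← trace_conjTranspose_mul_self_eq_zero_iff, ← frobenius_eq_trace]
  exact DFunLike.congr_fun hx x

end Frobenius

section LogEuclidean

/-- The matrix exponential of a symmetric matrix, as a symmetric matrix. -/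
def expSelfAdjoint (A : selfAdjoint (Mat n)) : selfAdjoint (Mat n) :=
  ⟨exp (A : Mat n), A.2.exp⟩

theorem contDiff_expSelfAdjoint {k : WithTop ℕ∞} :
    ContDiff ℝ k (expSelfAdjoint : selfAdjoint (Mat n) → selfAdjoint (Mat n)) :=
  contDiff_selfAdjoint_mk (contDiff_matrix_exp.comp (selfAdjointSubtypeL n).contDiff) _

theorem coe_fderiv_expSelfAdjoint (A B : selfAdjoint (Mat n)) :
    (fderiv ℝ expSelfAdjoint A B : Mat n) = fderiv ℝ exp (A : Mat n) B := by
  rw [coe_fderiv_selfAdjoint (contDiff_expSelfAdjoint.differentiable one_ne_zero A)]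
  exact DFunLike.congr_fun ((contDiff_matrix_exp.differentiable one_ne_zero
    (A : Mat n)).hasFDerivAt.comp A (selfAdjointSubtypeL n).hasFDerivAt).fderiv B

theorem fderiv_expSelfAdjoint_bijective (A : selfAdjoint (Mat n)) :
    Function.Bijective (fderiv ℝ expSelfAdjoint A) := by
  have hinj : Function.Injective (fderiv ℝ expSelfAdjoint A) := fun B C hBC =>
    Subtype.ext (fderiv_exp_injective (isHermitian_iff_isSymm.1 A.2) (by
      rw [← coe_fderiv_expSelfAdjoint, hBC, coe_fderiv_expSelfAdjoint]))
  exact ⟨hinj, LinearMap.injective_iff_surjective.1 hinj⟩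

/-- The matrix logarithm as a chart of `Sym_n⁺`. -/
def logChart (n : ℕ) : SPDChart n (selfAdjoint (Mat n)) :=
  .ofInverse expSelfAdjoint (fun X => ⟨matLog X, isHermitian_iff_isSymm.2 (isSymm_matLog X)⟩)
    contDiff_expSelfAdjoint (fun A => posDef_exp (isHermitian_iff_isSymm.1 A.2))
    fderiv_expSelfAdjoint_bijective
    (fun A => Subtype.ext (matLog_exp (isHermitian_iff_isSymm.1 A.2))) (fun _ hP => exp_matLog hP)

theorem coe_logChart_toFun {P : Mat n} (hP : P.PosDef) :
    ((logChart n).toFun P : Mat n) = matLog P :=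
  congrArg matLog (hP.isHermitian.isSelfAdjoint.coe_selfAdjointPart_apply ℝ)

theorem dMatLog_eq {P V : Mat n} (hP : P.PosDef) (hV : V.IsSymm) :
    dMatLog P V = (fderiv ℝ (logChart n).toFun P V : Mat n) := by
  ext i j
  let entry : selfAdjoint (Mat n) →L[ℝ] ℝ :=
    (Matrix.entryLinearMap ℝ ℝ i j).toContinuousLinearMap ∘L selfAdjointSubtypeL n
  have hline := (entry.hasFDerivAt.comp P ((logChart n).hasFDerivAt_toFun hP)).hasLineDerivAt V
  refine (HasDerivAt.congr_of_eventuallyEq hline ?_).deriv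
  filter_upwards [eventually_posDef_add_smul hP hV] with t ht
  exact congrArg (fun M : Mat n => M i j) (coe_logChart_toFun ht).symm

/-- The matrix logarithm as a flat chart for the Log-Euclidean metric. -/
def leChart (n : ℕ) : FlatChart (leMetric n) (selfAdjoint (Mat n)) where
  toSPDChart := logChart n
  form := frobeniusComap (selfAdjointSubtypeL n)
  form_symm _ _ := frobenius_comm _ _
  form_injective := frobeniusComap_injective Subtype.val_injective
  metric_eq _ _ _ hP hV hW := congrArg₂ frobenius (dMatLog_eq hP hV) (dMatLog_eq hP hW)

theorem isGyroisometry_leftGyrotranslation_leMetric (A : SPD n) :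
    IsGyroisometry (leMetric n) (leftGyrotranslation (leMetric n) A) :=
  (leChart n).isGyroisometry_leftGyrotranslation A

end LogEuclidean

/-! ### The Log-Cholesky metric -/

section LowerTriangular

variable {m : Type*} [Fintype m] [LinearOrder m]

theorem mul_apply_self_of_isLowerTriangular {R : Type*} [NonUnitalNonAssocSemiring R]
    {L M : Matrix m m R} (hL : L.IsLowerTriangular) (hM : M.IsLowerTriangular) (i : m) :
    (L * M) i i = L i i * M i i := by
  rw [Matrix.mul_apply]
  refine Finset.sum_eq_single i (fun j _ hj => ?_) fun h => (h (Finset.mem_univ i)).elim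
  rcases lt_or_gt_of_ne hj with hji | hij
  · rw [hM hji, mul_zero]
  · rw [hL hij, zero_mul]

theorem isLowerTriangular_inv {R : Type*} [CommRing R] {L : Matrix m m R}
    (hL : L.IsLowerTriangular) (hu : IsUnit L.det) : L⁻¹.IsLowerTriangular :=
  have : Invertible L := L.invertibleOfIsUnitDet hu
  blockTriangular_inv_of_blockTriangular hL

theorem apply_self_ne_zero_of_isLowerTriangular {R : Type*} [CommRing R] [Nontrivial R]
    {L : Matrix m m R} (hL : L.IsLowerTriangular) (hu : IsUnit L.det) (i : m) : L i i ≠ 0 := by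
  rw [det_of_isLowerTriangular L hL, IsUnit.prod_univ_iff] at hu
  exact (hu i).ne_zero

theorem eq_one_of_isLowerTriangular_of_mul_transpose_eq_one {R : Type*} [CommRing R] [LinearOrder R]
    [IsStrictOrderedRing R] {N : Matrix m m R} (hN : N.IsLowerTriangular) (hpos : ∀ i, 0 < N i i)
    (hNN : N * Nᵀ = 1) : N = 1 := by
  have hNt : Nᵀ.IsLowerTriangular := by
    rw [← inv_eq_right_inv hNN]
    exact isLowerTriangular_inv hN (isUnit_det_of_right_inverse hNN)
  ext i j
  rcases lt_trichotomy i j with h | rfl | h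
  · rw [hN h, one_apply_ne h.ne]
  · have hsq := mul_apply_self_of_isLowerTriangular hN hNt i
    rw [hNN, one_apply_eq, transpose_apply] at hsq
    rw [one_apply_eq]
    exact (mul_self_eq_one_iff.1 hsq.symm).resolve_right fun h => by linarith [hpos i]
  · rw [one_apply_ne h.ne']
    exact hNt h

theorem exists_isLowerTriangular_mul_transpose_eq [LocallyFiniteOrderBot m] {P : Matrix m m ℝ}
    (hP : P.PosDef) : ∃ M : Matrix m m ℝ, M.IsLowerTriangular ∧ M * Mᵀ = P := by
  have hunit : IsUnit (LDL.lowerInv hP) := isUnit_of_invertible _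
  have hlower : (LDL.lower hP).IsLowerTriangular :=
    isLowerTriangular_inv (fun _ _ hij => LDL.lowerInv_triangular hP hij)
      ((isUnit_iff_isUnit_det _).1 hunit)
  have hdiag : ∀ i, 0 < LDL.diagEntries hP i := by
    have hconj := hP.mul_mul_conjTranspose_same (vecMul_injective_of_isUnit hunit)
    rw [← LDL.diag_eq_lowerInv_conj] at hconj
    exact posDef_diagonal_iff.1 hconj
  have hsqrt : diagonal (fun i => √(LDL.diagEntries hP i)) *
      (diagonal fun i => √(LDL.diagEntries hP i))ᵀ = LDL.diag hP := by
    rw [diagonal_transpose, diagonal_mul_diagonal]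
    exact congrArg diagonal (funext fun i => Real.mul_self_sqrt (hdiag i).le)
  refine ⟨LDL.lower hP * diagonal fun i => √(LDL.diagEntries hP i),
    BlockTriangular.mul hlower (blockTriangular_diagonal _), ?_⟩
  conv_rhs => rw [← LDL.lower_conj_diag hP, conjTranspose_eq_transpose_of_trivial, ← hsqrt]
  rw [transpose_mul]
  simp only [mul_assoc]

end LowerTriangular

section Cholesky

theorem exists_isCholeskyFactor {P : Mat n} (hP : P.PosDef) : ∃ L, IsCholeskyFactor P L := by
  obtain ⟨M, hM, hMP⟩ := exists_isLowerTriangular_mul_transpose_eq hP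
  have hdet : IsUnit M.det := by
    refine isUnit_of_mul_isUnit_left (y := Mᵀ.det) ?_
    rw [← det_mul, hMP]
    exact hP.det_pos.ne'.isUnit
  have hdiag := apply_self_ne_zero_of_isLowerTriangular hM hdet
  let signs : Mat n := diagonal fun i => (SignType.sign (M i i) : ℝ)
  have hsigns : signs.IsLowerTriangular := blockTriangular_diagonal _
  have hsigns_mul : signs * signsᵀ = 1 := by
    rw [diagonal_transpose, diagonal_mul_diagonal, ← diagonal_one]
    refine congrArg diagonal (funext fun i => ?_)
    rcases lt_or_gt_of_ne (hdiag i) with h | h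
    · rw [sign_neg h, SignType.coe_neg_one, neg_mul_neg, one_mul]
    · rw [sign_pos h, SignType.coe_one, one_mul]
  refine ⟨M * signs, fun i j hij => hM.mul hsigns hij, fun i => ?_, ?_⟩
  · rw [mul_apply_self_of_isLowerTriangular hM hsigns,
      show signs i i = _ from diagonal_apply_eq _ i, self_mul_sign]
    exact abs_pos.2 (hdiag i)
  · rw [transpose_mul, mul_assoc, ← mul_assoc signs, hsigns_mul, one_mul, hMP]

theorem isCholeskyFactor_cholesky {P : Mat n} (hP : P.PosDef) : IsCholeskyFactor P (cholesky P) :=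
  Classical.epsilon_spec (exists_isCholeskyFactor hP)

theorem isLowerTriangular_lowerHalf (Z : Mat n) : (lowerHalf Z).IsLowerTriangular := by
  intro i j hij
  have hlt : i < j := hij
  simp [lowerHalf, hlt.not_gt, hlt.ne]

theorem lowerHalf_add_transpose {Z : Mat n} (hZ : Z.IsSymm) :
    lowerHalf Z + (lowerHalf Z)ᵀ = Z := by
  ext i j
  rcases lt_trichotomy i j with h | rfl | h
  · simp [lowerHalf, h, h.not_gt, h.ne, hZ.apply j i]
  · simp [lowerHalf]
  · simp [lowerHalf, h, h.not_gt, h.ne]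

theorem lowerHalf_add_transpose_of_isLowerTriangular {Z : Mat n} (hZ : Z.IsLowerTriangular) :
    lowerHalf (Z + Zᵀ) = Z := by
  ext i j
  rcases lt_trichotomy i j with h | rfl | h
  · simp [lowerHalf, h.not_gt, h.ne, hZ h]
  · simp [lowerHalf]
  · simp [lowerHalf, h, hZ h]

end Cholesky

namespace IsCholeskyFactor

variable {P L : Mat n}

theorem isLowerTriangular (h : IsCholeskyFactor P L) : L.IsLowerTriangular :=
  fun i j hij => h.lower i j hij

theorem isUnit_det (h : IsCholeskyFactor P L) : IsUnit L.det := by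
  rw [det_of_isLowerTriangular L h.isLowerTriangular]
  exact (Finset.prod_pos fun i _ => h.diag_pos i).ne'.isUnit

theorem posDef (h : IsCholeskyFactor P L) : P.PosDef := by
  rw [← h.mul_transpose, ← conjTranspose_eq_transpose_of_trivial]
  exact .mul_conjTranspose_self _
    (vecMul_injective_of_isUnit ((isUnit_iff_isUnit_det L).2 h.isUnit_det))

/-- If `L Lᵀ = M Mᵀ`, then `M⁻¹ L` is orthogonal and lower triangular with positive diagonal. -/
theorem unique {M : Mat n} (hL : IsCholeskyFactor P L) (hM : IsCholeskyFactor P M) : L = M := by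
  have hMu := hM.isUnit_det
  have hN : (M⁻¹ * L).IsLowerTriangular :=
    (isLowerTriangular_inv hM.isLowerTriangular hMu).mul hL.isLowerTriangular
  have hLN : M * (M⁻¹ * L) = L := mul_nonsing_inv_cancel_left _ _ hMu
  have hpos (i : Fin n) : 0 < (M⁻¹ * L) i i := by
    refine pos_of_mul_pos_right (a := M i i) ?_ (hM.diag_pos i).le
    rw [← mul_apply_self_of_isLowerTriangular hM.isLowerTriangular hN, hLN]
    exact hL.diag_pos i
  have hNN : (M⁻¹ * L) * (M⁻¹ * L)ᵀ = 1 := by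
    rw [transpose_mul, mul_assoc, ← mul_assoc L, hL.mul_transpose, ← hM.mul_transpose, mul_assoc M,
      ← transpose_mul, nonsing_inv_mul _ hMu, transpose_one, mul_one, nonsing_inv_mul _ hMu]
  rw [← hLN, eq_one_of_isLowerTriangular_of_mul_transpose_eq_one hN hpos hNN, mul_one]

theorem cholesky_eq (h : IsCholeskyFactor P L) : cholesky P = L :=
  (isCholeskyFactor_cholesky h.posDef).unique h

theorem isLowerTriangular_dCholesky (h : IsCholeskyFactor P L) (V : Mat n) :
    (dCholesky P V).IsLowerTriangular := by
  rw [dCholesky, h.cholesky_eq]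
  exact h.isLowerTriangular.mul (isLowerTriangular_lowerHalf _)

theorem dCholesky_eq (h : IsCholeskyFactor P L) {X : Mat n} (hX : X.IsLowerTriangular) :
    dCholesky P (X * Lᵀ + L * Xᵀ) = X := by
  have hu := h.isUnit_det
  have hconj : L⁻¹ * (X * Lᵀ + L * Xᵀ) * (L⁻¹)ᵀ = L⁻¹ * X + (L⁻¹ * X)ᵀ := by
    rw [transpose_nonsing_inv, mul_add, add_mul, transpose_mul, transpose_nonsing_inv,
      ← mul_assoc L⁻¹ X, mul_nonsing_inv_cancel_right _ _ (isUnit_det_transpose L hu),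
      nonsing_inv_mul_cancel_left _ _ hu]
  rw [dCholesky, h.cholesky_eq, hconj, lowerHalf_add_transpose_of_isLowerTriangular
    ((isLowerTriangular_inv h.isLowerTriangular hu).mul hX), mul_nonsing_inv_cancel_left _ _ hu]

theorem dCholesky_mul_transpose_add (h : IsCholeskyFactor P L) {V : Mat n} (hV : V.IsSymm) :
    dCholesky P V * Lᵀ + L * (dCholesky P V)ᵀ = V := by
  have hu := h.isUnit_det
  have hconj_symm : (L⁻¹ * V * (L⁻¹)ᵀ).IsSymm := by
    rw [Matrix.IsSymm, transpose_mul, transpose_mul, transpose_transpose, hV.eq, mul_assoc]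
  rw [dCholesky, h.cholesky_eq, transpose_mul, ← mul_assoc, ← add_mul, ← mul_add,
    lowerHalf_add_transpose hconj_symm, transpose_nonsing_inv, mul_assoc L⁻¹,
    mul_nonsing_inv_cancel_left _ _ hu,
    nonsing_inv_mul_cancel_right _ _ (isUnit_det_transpose L hu)]

end IsCholeskyFactor

section LogCholesky

/-- The entries of a matrix as coordinates, so that calculus can be done entrywise. -/
def ofL (n : ℕ) : (Fin n → Fin n → ℝ) ≃L[ℝ] Mat n :=
  (ofLinearEquiv ℝ).toContinuousLinearEquiv

theorem contDiff_matrix {E : Type*} [NormedAddCommGroup E] [NormedSpace ℝ E] {k : WithTop ℕ∞}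
    {f : E → Mat n} (hf : ∀ i j, ContDiff ℝ k fun x => f x i j) : ContDiff ℝ k f :=
  (ofL n).contDiff.comp (contDiff_pi.2 fun i => contDiff_pi.2 (hf i))

theorem hasDerivAt_matrix {f : ℝ → Mat n} {f' : Mat n} {t : ℝ}
    (hf : ∀ i j, HasDerivAt (fun x => f x i j) (f' i j) t) : HasDerivAt f f' t :=
  (ofL n).hasFDerivAt.comp_hasDerivAt t (hasDerivAt_pi.2 fun i => hasDerivAt_pi.2 (hf i))

/-- The space of lower triangular matrices, onto which the Log-Cholesky chart maps. -/
def lowerTriangular (n : ℕ) : Submodule ℝ (Mat n) where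
  carrier := {L | L.IsLowerTriangular}
  add_mem' := BlockTriangular.add
  zero_mem' := blockTriangular_zero
  smul_mem' r L hL i j hij := by rw [Matrix.smul_apply, hL hij, smul_zero]

/-- The matrix with diagonal entries `d i` that agrees with `X` off the diagonal. -/
def replaceDiag (X : Mat n) (d : Fin n → ℝ) : Mat n :=
  Matrix.of fun i j => if i = j then d i else X i j

theorem replaceDiag_apply_self (X : Mat n) (d : Fin n → ℝ) (i : Fin n) :
    replaceDiag X d i i = d i :=
  if_pos rfl

theorem replaceDiag_apply_of_ne (X : Mat n) (d : Fin n → ℝ) {i j : Fin n} (h : i ≠ j) :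
    replaceDiag X d i j = X i j :=
  if_neg h

theorem isLowerTriangular_replaceDiag {X : Mat n} (hX : X.IsLowerTriangular) (d : Fin n → ℝ) :
    (replaceDiag X d).IsLowerTriangular := fun i j hij =>
  (replaceDiag_apply_of_ne X d (LT.lt.ne (a := i) (b := j) hij)).trans (hX hij)

/-- Exponentiation of the diagonal entries, which turns lower triangular matrices into Cholesky
factors. -/
def diagExp (Y : Mat n) : Mat n :=
  replaceDiag Y fun i => Real.exp (Y i i)

/-- The differential of `diagExp` at `Y`. -/
def dDiagExp (Y A : Mat n) : Mat n :=
  replaceDiag A fun i => Real.exp (Y i i) * A i i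

/-- The inverse of `dDiagExp Y`. -/
def dDiagLog (Y X : Mat n) : Mat n :=
  replaceDiag X fun i => X i i / Real.exp (Y i i)

/-- The inverse of `diagExp` on Cholesky factors, which takes the logarithms of the diagonal
entries. The strictly upper part is discarded so that it is defined on all matrices. -/
def diagLog (L : Mat n) : lowerTriangular n :=
  ⟨Matrix.of fun i j => if i = j then Real.log (L i j) else if j < i then L i j else 0,
    fun i j hij => by
      have hlt : i < j := hij
      simp [hlt.ne, hlt.not_gt]⟩

theorem diagLog_diagExp (Y : lowerTriangular n) : diagLog (diagExp (Y : Mat n)) = Y := by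
  ext i j
  rcases lt_trichotomy i j with h | rfl | h
  · simp [diagLog, h.ne, h.not_gt, Y.2 h]
  · simp [diagLog, diagExp, replaceDiag_apply_self]
  · simp [diagLog, diagExp, replaceDiag_apply_of_ne, h.ne', h]

theorem diagExp_diagLog {L : Mat n} (hL : L.IsLowerTriangular) (hpos : ∀ i, 0 < L i i) :
    diagExp (diagLog L : Mat n) = L := by
  ext i j
  rcases lt_trichotomy i j with h | rfl | h
  · simp [diagExp, replaceDiag_apply_of_ne, diagLog, h.ne, h.not_gt, hL h]
  · simp [diagExp, replaceDiag_apply_self, diagLog, Real.exp_log (hpos i)]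
  · simp [diagExp, replaceDiag_apply_of_ne, diagLog, h.ne', h]

theorem dDiagLog_dDiagExp (Y A : Mat n) : dDiagLog Y (dDiagExp Y A) = A := by
  ext i j
  by_cases hij : i = j <;> simp [dDiagExp, dDiagLog, replaceDiag, hij]

theorem dDiagExp_dDiagLog (Y X : Mat n) : dDiagExp Y (dDiagLog Y X) = X := by
  ext i j
  by_cases hij : i = j <;> simp [dDiagExp, dDiagLog, replaceDiag, hij, mul_div_cancel₀]

theorem contDiff_diagExp {k : WithTop ℕ∞} : ContDiff ℝ k (diagExp : Mat n → Mat n) := by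
  have hentry (i j : Fin n) : ContDiff ℝ k fun X : Mat n => X i j :=
    (entryLinearMap ℝ ℝ i j).toContinuousLinearMap.contDiff
  refine contDiff_matrix fun i j => ?_
  rcases eq_or_ne i j with rfl | hij
  · simpa only [diagExp, replaceDiag_apply_self] using (hentry i i).exp
  · simpa only [diagExp, replaceDiag_apply_of_ne _ _ hij] using hentry i j

theorem hasLineDerivAt_diagExp (Y A : Mat n) : HasLineDerivAt ℝ diagExp (dDiagExp Y A) Y A := by
  have hentry (i j : Fin n) : HasDerivAt (fun t : ℝ => (Y + t • A) i j) (A i j) 0 :=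
    hasDerivAt_add_smul (Y i j) (A i j) 0
  refine hasDerivAt_matrix fun i j => ?_
  rcases eq_or_ne i j with rfl | hij
  · simpa only [diagExp, dDiagExp, replaceDiag_apply_self, zero_smul, add_zero]
      using (hentry i i).exp
  · simpa only [diagExp, dDiagExp, replaceDiag_apply_of_ne _ _ hij] using hentry i j

theorem triMetric_diagExp (Y : Mat n) {A : Mat n} (hA : A.IsLowerTriangular) (B : Mat n) :
    triMetric n (diagExp Y) (dDiagExp Y A) (dDiagExp Y B) = frobenius A B := by
  have hdiag (i : Fin n) : dDiagExp Y A i i * dDiagExp Y B i i / diagExp Y i i ^ 2 =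
      ∑ j, if j = i then A i j * B i j else 0 := by
    simp only [dDiagExp, diagExp, replaceDiag_apply_self, Finset.sum_ite_eq', Finset.mem_univ,
      if_true]
    field_simp
  simp only [triMetric, frobenius, hdiag, ← Finset.sum_add_distrib]
  refine Finset.sum_congr rfl fun i _ => Finset.sum_congr rfl fun j _ => ?_
  rcases lt_trichotomy i j with h | rfl | h
  · simp [h.not_gt, h.ne', hA h]
  · simp
  · simp [h, h.ne, dDiagExp, replaceDiag_apply_of_ne _ _ h.ne']

/-- The inverse `Y ↦ L Lᵀ`, with `L = diagExp Y`, of the Log-Cholesky chart. -/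
def expCholesky (Y : lowerTriangular n) : selfAdjoint (Mat n) :=
  ⟨diagExp (Y : Mat n) * star (diagExp (Y : Mat n)), .mul_star_self _⟩

theorem isCholeskyFactor_expCholesky (Y : lowerTriangular n) :
    IsCholeskyFactor (expCholesky Y : Mat n) (diagExp (Y : Mat n)) where
  lower i j hij := isLowerTriangular_replaceDiag Y.2 _ hij
  diag_pos i := by
    rw [diagExp, replaceDiag_apply_self]
    exact Real.exp_pos _
  mul_transpose := rfl

theorem contDiff_expCholesky {k : WithTop ℕ∞} :
    ContDiff ℝ k (expCholesky : lowerTriangular n → selfAdjoint (Mat n)) :=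
  have hdiagExp : ContDiff ℝ k fun Y : lowerTriangular n => diagExp (Y : Mat n) :=
    contDiff_diagExp.comp (lowerTriangular n).subtypeL.contDiff
  contDiff_selfAdjoint_mk (hdiagExp.mul ((starL' ℝ).contDiff.comp hdiagExp)) _

theorem coe_fderiv_expCholesky (Y A : lowerTriangular n) : (fderiv ℝ expCholesky Y A : Mat n) =
    dDiagExp (Y : Mat n) (A : Mat n) * (diagExp (Y : Mat n))ᵀ +
      diagExp (Y : Mat n) * (dDiagExp (Y : Mat n) (A : Mat n))ᵀ := by
  have hdiff : DifferentiableAt ℝ expCholesky Y := contDiff_expCholesky.differentiable one_ne_zero Y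
  have hline : HasDerivAt (fun t : ℝ => diagExp ((Y : Mat n) + t • (A : Mat n))) _ 0 :=
    hasLineDerivAt_diagExp (Y : Mat n) (A : Mat n)
  have hmul := hline.fun_mul hline.star
  simp only [zero_smul, add_zero] at hmul
  have hcoe := (selfAdjointSubtypeL n).hasFDerivAt.comp Y hdiff.hasFDerivAt
  exact (hcoe.hasLineDerivAt A).unique hmul

theorem dCholesky_fderiv_expCholesky (Y A : lowerTriangular n) :
    dCholesky (expCholesky Y : Mat n) (fderiv ℝ expCholesky Y A : Mat n) =
      dDiagExp (Y : Mat n) (A : Mat n) := by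
  rw [coe_fderiv_expCholesky]
  exact (isCholeskyFactor_expCholesky Y).dCholesky_eq (isLowerTriangular_replaceDiag A.2 _)

theorem fderiv_expCholesky_bijective (Y : lowerTriangular n) :
    Function.Bijective (fderiv ℝ expCholesky Y) := by
  have hfactor := isCholeskyFactor_expCholesky Y
  refine Function.bijective_iff_has_inverse.2
    ⟨fun V => ⟨dDiagLog Y (dCholesky (expCholesky Y : Mat n) V),
      isLowerTriangular_replaceDiag (hfactor.isLowerTriangular_dCholesky V) _⟩,
    fun A => ?_, fun V => ?_⟩
  · exact Subtype.ext (by simp only [dCholesky_fderiv_expCholesky, dDiagLog_dDiagExp])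
  · refine Subtype.ext ?_
    rw [coe_fderiv_expCholesky, dDiagExp_dDiagLog]
    exact hfactor.dCholesky_mul_transpose_add (isHermitian_iff_isSymm.1 V.2)

/-- The chart of `Sym_n⁺` that sends `P` to `diagLog L`, with `L` the Cholesky factor of `P`. -/
def logCholeskyChart (n : ℕ) : SPDChart n (lowerTriangular n) :=
  .ofInverse expCholesky (fun P => diagLog (cholesky P)) contDiff_expCholesky
    (fun Y => (isCholeskyFactor_expCholesky Y).posDef) fderiv_expCholesky_bijective
    (fun Y => by rw [(isCholeskyFactor_expCholesky Y).cholesky_eq, diagLog_diagExp])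
    (fun P hP => by
      have hfactor := isCholeskyFactor_cholesky hP
      rw [← (isCholeskyFactor_expCholesky _).mul_transpose,
        diagExp_diagLog hfactor.isLowerTriangular hfactor.diag_pos, hfactor.mul_transpose])

theorem cholesky_eq_diagExp {P : Mat n} (hP : P.PosDef) :
    cholesky P = diagExp ((logCholeskyChart n).toFun P : Mat n) := by
  rw [← (isCholeskyFactor_expCholesky _).cholesky_eq]
  exact congrArg cholesky ((logCholeskyChart n).left_inv P hP).symm

theorem dCholesky_eq_dDiagExp {P V : Mat n} (hP : P.PosDef) (hV : V.IsSymm) :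
    dCholesky P V = dDiagExp ((logCholeskyChart n).toFun P : Mat n)
      (fderiv ℝ (logCholeskyChart n).toFun P V : Mat n) := by
  rw [← dCholesky_fderiv_expCholesky,
    coe_fderiv_selfAdjoint (contDiff_expCholesky.differentiable one_ne_zero _)]
  exact (congrArg₂ dCholesky ((logCholeskyChart n).left_inv P hP)
    ((logCholeskyChart n).fderiv_invFun_fderiv_toFun hP hV)).symm

/-- The Log-Cholesky chart as a flat chart for the Log-Cholesky metric. -/
def lcChart (n : ℕ) : FlatChart (lcMetric n) (lowerTriangular n) where
  toSPDChart := logCholeskyChart n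
  form := frobeniusComap (lowerTriangular n).subtypeL
  form_symm _ _ := frobenius_comm _ _
  form_injective := frobeniusComap_injective Subtype.val_injective
  metric_eq P V W hP hV hW := by
    rw [lcMetric, cholesky_eq_diagExp hP, dCholesky_eq_dDiagExp hP hV,
      dCholesky_eq_dDiagExp hP hW]
    exact triMetric_diagExp _ (Subtype.prop _) _

theorem isGyroisometry_leftGyrotranslation_lcMetric (A : SPD n) :
    IsGyroisometry (lcMetric n) (leftGyrotranslation (lcMetric n) A) :=
  (lcChart n).isGyroisometry_leftGyrotranslation A

end LogCholesky

/-! ### The Affine-Invariant metric -/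

section AffineInvariantParallel

theorem hasDerivWithinAt_matrix_inv {γ : ℝ → Mat n} {v : Mat n} {s : Set ℝ} {t : ℝ}
    (hu : IsUnit (γ t)) (hγ : HasDerivWithinAt γ v s t) :
    HasDerivWithinAt (fun r => (γ r)⁻¹) (-((γ t)⁻¹ * v * (γ t)⁻¹)) s t := by
  obtain ⟨u, hu⟩ := hu
  have hinv := hasFDerivAt_ringInverse (𝕜 := ℝ) u
  rw [hu] at hinv
  simp_rw [Matrix.nonsing_inv_eq_ringInverse]
  simpa [← hu, Function.comp_def] using hinv.comp_hasDerivWithinAt t hγ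

theorem lineDeriv_aiMetric {P : Mat n} (hP : IsUnit P) (U V W : Mat n) :
    lineDeriv ℝ (fun X : Mat n => aiMetric n X V W) P U =
      -aiMetric n P (U * P⁻¹ * V + V * P⁻¹ * U) W := by
  have hinv : HasDerivAt (fun t : ℝ => (P + t • U)⁻¹) (-(P⁻¹ * U * P⁻¹)) 0 := by
    rw [← hasDerivWithinAt_univ]
    simpa using hasDerivWithinAt_matrix_inv (γ := fun t : ℝ => P + t • U) (t := 0) (s := univ)
      (by simpa) (hasDerivAt_add_smul P U 0).hasDerivWithinAt
  have htrace := (Matrix.traceLinearMap (Fin n) ℝ ℝ).toContinuousLinearMap.hasFDerivAt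
    |>.comp_hasDerivAt (0 : ℝ) (((hinv.mul_const V).fun_mul hinv).mul_const W)
  refine htrace.deriv.trans ?_
  simp only [LinearMap.coe_toContinuousLinearMap', Matrix.traceLinearMap_apply, aiMetric,
    zero_smul, add_zero, ← Matrix.trace_neg]
  congr 1
  noncomm_ring

/-- The Christoffel symbols (of the second kind) of the Affine-Invariant metric: the covariant
derivative along a curve `γ` with velocity `v` is `X' + Γ (v, X)`. -/
def aiChristoffel (P v X : Mat n) : Mat n :=
  -((2⁻¹ : ℝ) • (v * P⁻¹ * X + X * P⁻¹ * v))

theorem aiMetric_add_christoffel {P : Mat n} (hP : IsUnit P) (v X X' W : Mat n) :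
    aiMetric n P X' W + christoffel (aiMetric n) P v X W =
      aiMetric n P (X' + aiChristoffel P v X) W := by
  have cyc (A B : Mat n) :
      (P⁻¹ * W * P⁻¹ * A * P⁻¹ * B).trace = (P⁻¹ * A * P⁻¹ * B * P⁻¹ * W).trace := by
    simpa only [← mul_assoc] using Matrix.trace_mul_comm (P⁻¹ * W) (P⁻¹ * A * P⁻¹ * B)
  have cyc' : (P⁻¹ * v * P⁻¹ * W * P⁻¹ * X).trace = (P⁻¹ * X * P⁻¹ * v * P⁻¹ * W).trace := by
    simpa only [← mul_assoc] using Matrix.trace_mul_comm (P⁻¹ * v * P⁻¹ * W) (P⁻¹ * X)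
  rw [christoffel, lineDeriv_aiMetric hP, lineDeriv_aiMetric hP, lineDeriv_aiMetric hP]
  simp only [aiMetric, aiChristoffel, mul_add, add_mul, mul_neg, neg_mul, Matrix.mul_smul,
    Matrix.smul_mul, ← mul_assoc, Matrix.trace_neg, Matrix.trace_smul, Matrix.trace_add,
    smul_eq_mul, smul_add, cyc, cyc']
  ring

theorem isSymm_aiChristoffel {P v X : Mat n} (hP : P.IsSymm) (hv : v.IsSymm) (hX : X.IsSymm) :
    (aiChristoffel P v X).IsSymm := by
  simp only [Matrix.IsSymm, aiChristoffel, transpose_neg, transpose_smul, transpose_add,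
    transpose_mul, Matrix.transpose_nonsing_inv, hP.eq, hv.eq, hX.eq, ← mul_assoc,
    add_comm (X * P⁻¹ * v)]

theorem eq_zero_of_aiMetric_eq_zero {P Z : Mat n} (hP : P.PosDef) (hZ : Z.IsSymm)
    (h : ∀ W : Mat n, W.IsSymm → aiMetric n P Z W = 0) : Z = 0 := by
  have hPi : (P⁻¹)ᵀ = P⁻¹ := (isHermitian_iff_isSymm.1 hP.inv.isHermitian).eq
  have hY : (P⁻¹ * Z * P⁻¹)ᵀ = P⁻¹ * Z * P⁻¹ := by
    simp only [transpose_mul, hPi, hZ.eq, mul_assoc]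
  have hY0 : P⁻¹ * Z * P⁻¹ = 0 := by
    rw [← trace_conjTranspose_mul_self_eq_zero_iff, conjTranspose_eq_transpose_of_trivial, hY]
    simpa only [aiMetric, ← mul_assoc] using h _ hY
  exact hP.inv.isUnit.mul_right_eq_zero.1 (hP.inv.isUnit.mul_left_eq_zero.1 hY0)

theorem IsCurve.isSymm_velocity {γ v : ℝ → Mat n} (hγ : IsCurve γ v) {t : ℝ}
    (ht : t ∈ Icc (0 : ℝ) 1) : (v t).IsSymm :=
  isSymm_of_hasDerivWithinAt ht (hγ t ht).2 fun r hr =>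
    isHermitian_iff_isSymm.1 (hγ r hr).1.isHermitian

theorem isParallelAlong_aiMetric_iff {γ v X : ℝ → Mat n} (hγ : IsCurve γ v) :
    IsParallelAlong (aiMetric n) γ v X ↔ ∀ t ∈ Icc (0 : ℝ) 1, (X t).IsSymm ∧
      HasDerivWithinAt X (-aiChristoffel (γ t) (v t) (X t)) (Icc 0 1) t := by
  refine ⟨fun hX t ht => ?_, fun hX t ht => ⟨(hX t ht).1, _, (hX t ht).2, fun W _ => ?_⟩⟩
  · obtain ⟨hXs, X', hX', hparallel⟩ := hX t ht
    have hP := (hγ t ht).1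
    have hXs' := isSymm_of_hasDerivWithinAt ht hX' fun r hr => (hX r hr).1
    have covariant_symm : (X' + aiChristoffel (γ t) (v t) (X t)).IsSymm :=
      hXs'.add (isSymm_aiChristoffel (isHermitian_iff_isSymm.1 hP.isHermitian)
        (hγ.isSymm_velocity ht) hXs)
    have covariant_zero := eq_zero_of_aiMetric_eq_zero hP covariant_symm fun W hW => by
      rw [← aiMetric_add_christoffel hP.isUnit, hparallel W hW]
    exact ⟨hXs, eq_neg_of_add_eq_zero_left covariant_zero ▸ hX'⟩
  · rw [aiMetric_add_christoffel (hγ t ht).1.isUnit, neg_add_cancel]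
    simp [aiMetric]

end AffineInvariantParallel

section Congruence

theorem posDef_congruence {S P : Mat n} (hS : IsUnit S) (hP : P.PosDef) : (S * P * Sᵀ).PosDef :=
  (Matrix.IsUnit.posDef_star_right_conjugate_iff hS).2 hP

theorem isSymm_congruence {V : Mat n} (S : Mat n) (hV : V.IsSymm) : (S * V * Sᵀ).IsSymm := by
  simp only [Matrix.IsSymm, transpose_mul, transpose_transpose, hV.eq, mul_assoc]

theorem hasDerivWithinAt_congruence (S : Mat n) {X : ℝ → Mat n} {X' : Mat n} {s : Set ℝ} {t : ℝ}
    (hX : HasDerivWithinAt X X' s t) :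
    HasDerivWithinAt (fun r => S * X r * Sᵀ) (S * X' * Sᵀ) s t :=
  (hX.const_mul S).mul_const Sᵀ

theorem aiChristoffel_congruence {S : Mat n} (hS : IsUnit S) (P v X : Mat n) :
    aiChristoffel (S * P * Sᵀ) (S * v * Sᵀ) (S * X * Sᵀ) = S * aiChristoffel P v X * Sᵀ := by
  have hdet : IsUnit S.det := (Matrix.isUnit_iff_isUnit_det S).1 hS
  have cancel (A B : Mat n) :
      S * A * Sᵀ * (S * P * Sᵀ)⁻¹ * (S * B * Sᵀ) = S * (A * P⁻¹ * B) * Sᵀ := by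
    simp only [Matrix.mul_inv_rev, mul_assoc, Matrix.nonsing_inv_mul_cancel_left _ _ hdet,
      Matrix.mul_nonsing_inv_cancel_left _ _ (Matrix.isUnit_det_transpose S hdet)]
  simp only [aiChristoffel, cancel, mul_neg, neg_mul, Matrix.mul_smul, Matrix.smul_mul, mul_add,
    add_mul]

theorem IsCurve.congruence {S : Mat n} (hS : IsUnit S) {γ v : ℝ → Mat n} (hγ : IsCurve γ v) :
    IsCurve (fun t => S * γ t * Sᵀ) (fun t => S * v t * Sᵀ) := fun t ht =>
  ⟨posDef_congruence hS (hγ t ht).1, hasDerivWithinAt_congruence S (hγ t ht).2⟩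

theorem IsGeodesic.congruence {S : Mat n} (hS : IsUnit S) {γ v : ℝ → Mat n}
    (h : IsGeodesic (aiMetric n) γ v) :
    IsGeodesic (aiMetric n) (fun t => S * γ t * Sᵀ) (fun t => S * v t * Sᵀ) := by
  refine ⟨h.1.congruence hS, (isParallelAlong_aiMetric_iff (h.1.congruence hS)).2 fun t ht => ?_⟩
  obtain ⟨hv, hv'⟩ := (isParallelAlong_aiMetric_iff h.1).1 h.2 t ht
  refine ⟨isSymm_congruence S hv, ?_⟩
  simpa only [aiChristoffel_congruence hS, mul_neg, neg_mul] using hasDerivWithinAt_congruence S hv'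

end Congruence

section AffineInvariantGeodesic

theorem commute_exp_smul (T : Mat n) (s t : ℝ) : Commute T (exp (t • s • T)) :=
  (((Commute.refl T).smul_right s).smul_right t).exp_right

theorem aiChristoffel_exp {A T : Mat n} (h : Commute T (exp A)) (X : Mat n) :
    aiChristoffel (exp A) (T * exp A) X = -((2⁻¹ : ℝ) • (T * X + X * T)) := by
  have hdet := (Matrix.isUnit_iff_isUnit_det _).1 (Matrix.isUnit_exp A)
  rw [aiChristoffel, Matrix.mul_nonsing_inv_cancel_right _ _ hdet, h.eq, mul_assoc X,
    Matrix.nonsing_inv_mul_cancel_left _ _ hdet]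

theorem isCurve_exp {T : Mat n} (hT : T.IsSymm) :
    IsCurve (fun t => exp (t • T)) (fun t => T * exp (t • T)) := fun t _ =>
  ⟨posDef_exp (hT.smul t), (hasDerivAt_exp_smul_const' T t).hasDerivWithinAt⟩

/-- The transport of the symmetric matrix `V` along `t ↦ exp (t T)` by congruences with
`exp (t T / 2)`. -/
def expTransport (T V : Mat n) (t : ℝ) : Mat n :=
  exp (t • (2⁻¹ : ℝ) • T) * V * exp (t • (2⁻¹ : ℝ) • T)

theorem expTransport_zero (T V : Mat n) : expTransport T V 0 = V := by
  simp [expTransport]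

theorem expTransport_self (T : Mat n) (t : ℝ) : expTransport T T t = T * exp (t • T) := by
  rw [expTransport, ← (commute_exp_smul T 2⁻¹ t).eq, mul_assoc, smul_smul, exp_smul_mul_exp_smul,
    ← two_mul, mul_comm t, mul_inv_cancel_left₀ two_ne_zero]

theorem isSymm_expTransport {T V : Mat n} (hT : T.IsSymm) (hV : V.IsSymm) (t : ℝ) :
    (expTransport T V t).IsSymm := by
  have hexp : (exp (t • (2⁻¹ : ℝ) • T)).IsSymm :=
    isHermitian_iff_isSymm.1 (posDef_exp ((hT.smul _).smul t)).isHermitian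
  simpa only [hexp.eq, expTransport] using isSymm_congruence (exp (t • (2⁻¹ : ℝ) • T)) hV

theorem isParallelAlong_expTransport {T V : Mat n} (hT : T.IsSymm) (hV : V.IsSymm) :
    IsParallelAlong (aiMetric n) (fun t => exp (t • T)) (fun t => T * exp (t • T))
      (expTransport T V) := by
  refine (isParallelAlong_aiMetric_iff (isCurve_exp hT)).2 fun t _ =>
    ⟨isSymm_expTransport hT hV t, ?_⟩
  have commute_exp : Commute T (exp (t • T)) := by simpa using commute_exp_smul T 1 t
  rw [aiChristoffel_exp commute_exp, neg_neg]
  refine ((((hasDerivAt_exp_smul_const' ((2⁻¹ : ℝ) • T) t).mul_const V).mul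
    (hasDerivAt_exp_smul_const ((2⁻¹ : ℝ) • T) t)).congr_deriv ?_).hasDerivWithinAt
  simp only [expTransport, Matrix.smul_mul, Matrix.mul_smul, smul_add, mul_assoc]

theorem isGeodesic_exp {T : Mat n} (hT : T.IsSymm) :
    IsGeodesic (aiMetric n) (fun t => exp (t • T)) (fun t => T * exp (t • T)) :=
  ⟨isCurve_exp hT, by simpa only [funext (expTransport_self T)] using
    isParallelAlong_expTransport hT hT⟩

theorem IsGeodesic.velocity_eq {γ v : ℝ → Mat n} (h : IsGeodesic (aiMetric n) γ v)
    (h0 : γ 0 = 1) {t : ℝ} (ht : t ∈ Icc (0 : ℝ) 1) : v t = v 0 * γ t := by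
  have hconst := eq_of_hasDerivWithinAt_zero (f := fun t => v t * (γ t)⁻¹) (fun s hs => by
    obtain ⟨hP, hγ⟩ := h.1 s hs
    have hv := ((isParallelAlong_aiMetric_iff h.1).1 h.2 s hs).2
    refine (hv.mul (hasDerivWithinAt_matrix_inv hP.isUnit hγ)).congr_deriv ?_
    rw [aiChristoffel, neg_neg, ← two_smul ℝ, inv_smul_smul₀ two_ne_zero]
    noncomm_ring) ht
  rw [h0, inv_one, mul_one] at hconst
  rw [← hconst, Matrix.nonsing_inv_mul_cancel_right _ _ (h.1 t ht).1.det_pos.ne'.isUnit]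

theorem IsGeodesic.eq_exp {γ v : ℝ → Mat n} (h : IsGeodesic (aiMetric n) γ v) (h0 : γ 0 = 1)
    {t : ℝ} (ht : t ∈ Icc (0 : ℝ) 1) : γ t = exp (t • v 0) := by
  have hconst := eq_of_hasDerivWithinAt_zero (f := fun t => exp (t • -v 0) * γ t) (fun s hs => by
    have hγ := (h.1 s hs).2
    rw [h.velocity_eq h0 hs] at hγ
    refine ((hasDerivAt_exp_smul_const (-v 0) s).hasDerivWithinAt.mul hγ).congr_deriv ?_
    noncomm_ring) ht
  rw [zero_smul, exp_zero, one_mul, h0, smul_neg, ← neg_smul] at hconst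
  rw [← mul_one (exp _), ← hconst, ← mul_assoc, exp_smul_mul_exp_smul, add_neg_cancel, zero_smul,
    exp_zero, one_mul]

theorem IsGeodesic.eq_expTransport {γ v X : ℝ → Mat n} (h : IsGeodesic (aiMetric n) γ v)
    (h0 : γ 0 = 1) (hX : IsParallelAlong (aiMetric n) γ v X) {t : ℝ} (ht : t ∈ Icc (0 : ℝ) 1) :
    X t = expTransport (v 0) (X 0) t := by
  set A : Mat n := (2⁻¹ : ℝ) • v 0 with hA
  have hconst := eq_of_hasDerivWithinAt_zero
    (f := fun t => exp (t • -A) * X t * exp (t • -A)) (fun s hs => by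
      have commute_exp : Commute (v 0) (exp (s • v 0)) := by
        simpa using commute_exp_smul (v 0) 1 s
      have hX' := ((isParallelAlong_aiMetric_iff h.1).1 hX s hs).2
      rw [h.velocity_eq h0 hs, h.eq_exp h0 hs, aiChristoffel_exp commute_exp, neg_neg, smul_add,
        ← Matrix.smul_mul, ← Matrix.mul_smul, ← hA] at hX'
      refine (((hasDerivAt_exp_smul_const (-A) s).hasDerivWithinAt.mul hX').mul
        (hasDerivAt_exp_smul_const' (-A) s).hasDerivWithinAt).congr_deriv ?_
      simp only [Pi.mul_apply]
      noncomm_ring) ht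
  have cancel : exp (t • A) * exp (t • -A) = 1 := by
    rw [smul_neg, ← neg_smul, exp_smul_mul_exp_smul, add_neg_cancel, zero_smul, exp_zero]
  simp only [zero_smul, exp_zero, one_mul, mul_one] at hconst
  rw [expTransport, ← hconst, ← hA, ← mul_assoc, ← mul_assoc, cancel, one_mul, mul_assoc,
    mul_eq_one_comm.1 cancel, mul_one]

theorem IsGeodesic.velocity_zero_eq_matLog {γ v : ℝ → Mat n} (h : IsGeodesic (aiMetric n) γ v)
    (h0 : γ 0 = 1) : v 0 = matLog (γ 1) := by
  rw [h.eq_exp h0 (right_mem_Icc.2 zero_le_one), one_smul,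
    matLog_exp (h.1.isSymm_velocity (left_mem_Icc.2 zero_le_one))]

theorem IsGeodesic.eq_congruence_exp {S T : Mat n} (hS : IsUnit S) {γ v : ℝ → Mat n}
    (h : IsGeodesic (aiMetric n) γ v) (h0 : γ 0 = S * Sᵀ) (hv : v 0 = S * T * Sᵀ) {t : ℝ}
    (ht : t ∈ Icc (0 : ℝ) 1) : γ t = S * exp (t • T) * Sᵀ := by
  have hdet : IsUnit S.det := (Matrix.isUnit_iff_isUnit_det S).1 hS
  have cancel : S * S⁻¹ = 1 := Matrix.mul_nonsing_inv S hdet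
  have cancel' : S⁻¹ * S = 1 := Matrix.nonsing_inv_mul S hdet
  have conj_inv (Z : Mat n) : S⁻¹ * (S * Z * Sᵀ) * S⁻¹ᵀ = Z := by
    rw [mul_assoc S, ← mul_assoc, cancel', one_mul, mul_assoc, ← transpose_mul, cancel',
      transpose_one, mul_one]
  have start : S⁻¹ * γ 0 * S⁻¹ᵀ = 1 := by simpa only [h0, mul_one] using conj_inv 1
  have conj_eq := (h.congruence (Matrix.isUnit_nonsing_inv_iff.2 hS)).eq_exp start ht
  simp only [hv, conj_inv] at conj_eq
  rw [← conj_eq, mul_assoc S, mul_assoc (S⁻¹ * γ t), ← transpose_mul, cancel, transpose_one,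
    mul_one, ← mul_assoc, cancel, one_mul]

end AffineInvariantGeodesic

section AffineInvariantOperations

theorem riemLog_aiMetric_one (Q : SPD n) : riemLog (aiMetric n) (SPD.one n) Q = matLog Q.1 := by
  have hex : ∃ V : Mat n, ∃ γ v, IsGeodesic (aiMetric n) γ v ∧ γ 0 = (SPD.one n).1 ∧
      γ 1 = Q.1 ∧ v 0 = V :=
    ⟨_, _, _, isGeodesic_exp (isSymm_matLog Q.1), by simp [SPD.one],
      by simpa using exp_matLog Q.2, rfl⟩
  obtain ⟨γ, v, hγ, h0, h1, hv⟩ := Classical.epsilon_spec hex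
  rw [riemLog, ← hv, hγ.velocity_zero_eq_matLog h0, h1]

theorem transport_aiMetric_one (P : SPD n) {V : Mat n} (hV : V.IsSymm) :
    transport (aiMetric n) (SPD.one n) P V = expTransport (matLog P.1) V 1 := by
  have hex : ∃ W : Mat n, ∃ γ v X, IsGeodesic (aiMetric n) γ v ∧ γ 0 = (SPD.one n).1 ∧
      γ 1 = P.1 ∧ IsParallelAlong (aiMetric n) γ v X ∧ X 0 = V ∧ X 1 = W :=
    ⟨_, _, _, _, isGeodesic_exp (isSymm_matLog P.1), by simp [SPD.one],
      by simpa using exp_matLog P.2, isParallelAlong_expTransport (isSymm_matLog P.1) hV,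
      expTransport_zero _ V, rfl⟩
  obtain ⟨γ, v, X, hγ, h0, h1, hX, hX0, hX1⟩ := Classical.epsilon_spec hex
  rw [transport, ← hX1, hγ.eq_expTransport h0 hX (right_mem_Icc.2 zero_le_one), hX0,
    hγ.velocity_zero_eq_matLog h0, h1]

theorem riemExp_aiMetric {S T : Mat n} (hS : IsUnit S) (hT : T.IsSymm) {P : SPD n}
    (hP : S * Sᵀ = P.1) : (riemExp (aiMetric n) P (S * T * Sᵀ)).1 = S * exp T * Sᵀ := by
  have hex : ∃ Q : SPD n, ∃ γ v, IsGeodesic (aiMetric n) γ v ∧ γ 0 = P.1 ∧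
      v 0 = S * T * Sᵀ ∧ γ 1 = Q.1 :=
    ⟨⟨_, posDef_congruence hS (posDef_exp (hT.smul 1))⟩, _, _, (isGeodesic_exp hT).congruence hS,
      by simpa using hP, by simp, rfl⟩
  obtain ⟨γ, v, hγ, h0, hv, h1⟩ := Classical.epsilon_spec hex
  rw [riemExp, ← h1, hγ.eq_congruence_exp hS (h0.trans hP.symm) hv (right_mem_Icc.2 zero_le_one),
    one_smul]

/-- The symmetric square root of a positive definite matrix. -/
def spdSqrt (P : Mat n) : Mat n :=
  exp ((2⁻¹ : ℝ) • matLog P)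

theorem posDef_spdSqrt (P : Mat n) : (spdSqrt P).PosDef :=
  posDef_exp ((isSymm_matLog P).smul _)

theorem transpose_spdSqrt (P : Mat n) : (spdSqrt P)ᵀ = spdSqrt P :=
  (isHermitian_iff_isSymm.1 (posDef_spdSqrt P).isHermitian).eq

theorem spdSqrt_mul_self {P : Mat n} (hP : P.PosDef) : spdSqrt P * spdSqrt P = P := by
  rw [spdSqrt, exp_smul_mul_exp_smul, ← two_mul, mul_inv_cancel₀ two_ne_zero, one_smul,
    exp_matLog hP]

theorem expTransport_matLog_one (P V : Mat n) :
    expTransport (matLog P) V 1 = spdSqrt P * V * (spdSqrt P)ᵀ := by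
  rw [transpose_spdSqrt, expTransport, one_smul, spdSqrt]

theorem gyroAdd_aiMetric (P Q : SPD n) :
    (gyroAdd (aiMetric n) P Q).1 = spdSqrt P.1 * Q.1 * (spdSqrt P.1)ᵀ := by
  have hsq : spdSqrt P.1 * (spdSqrt P.1)ᵀ = P.1 := by
    rw [transpose_spdSqrt, spdSqrt_mul_self P.2]
  rw [gyroAdd, riemLog_aiMetric_one, transport_aiMetric_one P (isSymm_matLog _),
    expTransport_matLog_one, riemExp_aiMetric (posDef_spdSqrt P.1).isUnit (isSymm_matLog _) hsq,
    exp_matLog Q.2]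

theorem exists_gyroAdd_aiMetric_eq_one (P : SPD n) :
    ∃ N, gyroAdd (aiMetric n) N P = SPD.one n := by
  have hsymm := (isSymm_matLog P.1).neg
  have hsqrt : spdSqrt (exp (-matLog P.1)) = exp ((-2⁻¹ : ℝ) • matLog P.1) := by
    rw [spdSqrt, matLog_exp hsymm, smul_neg, neg_smul]
  have hP : P.1 = exp ((1 : ℝ) • matLog P.1) := by rw [one_smul, exp_matLog P.2]
  refine ⟨⟨exp (-matLog P.1), posDef_exp hsymm⟩, Subtype.ext ?_⟩
  rw [gyroAdd_aiMetric, transpose_spdSqrt, hsqrt]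
  nth_rw 2 [hP]
  rw [exp_smul_mul_exp_smul, exp_smul_mul_exp_smul]
  norm_num [SPD.one]

theorem matLog_orthogonal_congruence {O P : Mat n} (hO : O * Oᵀ = 1) (hP : P.PosDef) :
    matLog (O * P * Oᵀ) = O * matLog P * Oᵀ := by
  have hunit : IsUnit O :=
    (Matrix.isUnit_iff_isUnit_det O).2 (Matrix.isUnit_det_of_right_inverse hO)
  rw [← matLog_exp (isSymm_congruence O (isSymm_matLog P)), ← Matrix.inv_eq_right_inv hO,
    Matrix.exp_conj O _ hunit, exp_matLog hP]

theorem spdInner_aiMetric (P Q : SPD n) :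
    spdInner (aiMetric n) P Q = (matLog P.1 * matLog Q.1).trace := by
  rw [spdInner, riemLog_aiMetric_one, riemLog_aiMetric_one, aiMetric, inv_one, one_mul, mul_one]

theorem spdInner_aiMetric_orthogonal_congruence {O : Mat n} (hO : O * Oᵀ = 1) {P P' Q Q' : SPD n}
    (hP : P'.1 = O * P.1 * Oᵀ) (hQ : Q'.1 = O * Q.1 * Oᵀ) :
    spdInner (aiMetric n) P' Q' = spdInner (aiMetric n) P Q := by
  have hO' : Oᵀ * O = 1 := mul_eq_one_comm.1 hO
  have mul_conj (A B : Mat n) : O * A * Oᵀ * (O * B * Oᵀ) = O * (A * B) * Oᵀ := by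
    rw [mul_assoc O B, ← mul_assoc, mul_assoc (O * A), hO', mul_one, ← mul_assoc, mul_assoc O A]
  rw [spdInner_aiMetric, spdInner_aiMetric, hP, hQ, matLog_orthogonal_congruence hO P.2,
    matLog_orthogonal_congruence hO Q.2, mul_conj, Matrix.trace_mul_comm, ← mul_assoc, hO',
    one_mul]

end AffineInvariantOperations

/-- The action of the general linear group on `Sym_n⁺` by the congruences `P ↦ S P Sᵀ`. -/
instance congruenceAction : MulAction (GL (Fin n) ℝ) (SPD n) where
  smul S P := ⟨S.1 * P.1 * S.1ᵀ, posDef_congruence S.isUnit P.2⟩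
  one_smul P := Subtype.ext (by
    change (1 : Mat n) * P.1 * (1 : Mat n)ᵀ = P.1
    rw [transpose_one, one_mul, mul_one])
  mul_smul S T P := Subtype.ext (by
    change S.1 * T.1 * P.1 * (S.1 * T.1)ᵀ = S.1 * (T.1 * P.1 * T.1ᵀ) * S.1ᵀ
    simp only [transpose_mul, mul_assoc])

theorem coe_congruence_smul (S : GL (Fin n) ℝ) (P : SPD n) :
    (S • P).1 = S.1 * P.1 * S.1ᵀ := rfl

theorem isGyroisometry_leftGyrotranslation_aiMetric (A : SPD n) :
    IsGyroisometry (aiMetric n) (leftGyrotranslation (aiMetric n) A) := by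
  refine isGyroisometry_leftGyrotranslation_of_mulAction (G := GL (Fin n) ℝ)
    (fun P => ⟨(posDef_spdSqrt P.1).isUnit.unit, fun Q => Subtype.ext (gyroAdd_aiMetric P Q)⟩)
    exists_gyroAdd_aiMetric_eq_one (fun S hS Q => ?_) A
  have orthogonal : S.1 * S.1ᵀ = 1 := by
    simpa only [coe_congruence_smul, SPD.one, mul_one] using congrArg Subtype.val hS
  rw [spdNorm, spdNorm, spdInner_aiMetric_orthogonal_congruence orthogonal
    (coe_congruence_smul S Q) (coe_congruence_smul S Q)]

end SPDGyro

end

theorem mainTheorem9 (n : ℕ) (g : SPDGyro.MetricName) (P : SPDGyro.SPD n) :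
    SPDGyro.IsGyroisometry (g.tensor n) (SPDGyro.leftGyrotranslation (g.tensor n) P) := by
  cases g with
  | le => exact SPDGyro.isGyroisometry_leftGyrotranslation_leMetric P
  | lc => exact SPDGyro.isGyroisometry_leftGyrotranslation_lcMetric P
  | ai => exact SPDGyro.isGyroisometry_leftGyrotranslation_aiMetric P
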